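/- **Definitions.** An *SMC-category* is a bicategory $\mathbf B$ together with a symmetric monoidal structure $(\oplus,\mathbf 0)$ on every hom-category $\mathbf B(a,b)$, such that composition $\circ:\mathbf B(b,c)\times\mathbf B(a,b)\to\mathbf B(a,c)$ is coherently bilinear, that is: * for each $1$-cell $g$ the functor $g\circ-$, and for each $1$-cell $f$ the functor $-\circ f$, carries a symmetric strong monoidal structure; the structure isomorphisms $(g\circ f_1)\oplus(g\circ f_2)\cong g\circ(f_1\oplus f_2)$ and $\mathbf 0\cong g\circ\mathbf 0$ are natural in $g$, and the structure isomorphisms $(g_1\circ f)\oplus(g_2\circ f)\cong(g_1\oplus g_2)\circ f$ and $\mathbf 0\cong\mathbf 0\circ f$ are natural in $f$ (equivalently, the two adjoints $\mathbf B(b,c)\to\mathbf{CAT}(\mathbf B(a,b),\mathbf B(a,c))$ and $\mathbf B(a,b)\to\mathbf{CAT}(\mathbf B(b,c),\mathbf B(a,c))$ of $\circ$ are symmetric strong monoidal for the pointwise sum); * the isomorphisms $(g_1\oplus g_2)\circ-\cong(g_1\circ-)\oplus(g_2\circ-)$, $-\circ(f_1\oplus f_2)\cong(-\circ f_1)\oplus(-\circ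 f_2)$, $\mathbf 0\circ-\cong\mathbf 0$ and $-\circ\mathbf 0\cong\mathbf 0$ are isomorphisms of monoidal functors; * the associativity isomorphism of $\mathbf B$, as a transformation in each of its three variables separately, and the two unit isomorphisms of $\mathbf B$ are isomorphisms of monoidal functors. An *SMC-functor* $F:\mathbf B\to\mathbf C$ of SMC-categories is a (strong) functor of bicategories together with a symmetric strong monoidal structure on each functor $F:\mathbf B(a,b)\to\mathbf C(Fa,Fb)$, such that the constraint $F(g\circ f)\cong F(g)\circ F(f)$ is a monoidal transformation in $f$ for fixed $g$, and in $g$ for fixed $f$. Given SMC-functors $F,G:\mathbf B\to\mathbf C$, a *strong monoidal transformation* $\eta:F\Rightarrow G$ is a strong transformation of functors of bicategories such that, for all $0$-cells $a,b$, the natural isomorphism $\eta_b\circ F(f)\cong G(f)\circ\eta_a$ of functors of $f\in\mathbf B(a,b)$ is monoidal. $\mathbf{SMC\text{-}Cat}(\mathbf B,\mathbf C)$ is the bicategory of SMC-functors $\mathbf B\to\mathbf C$, strong monoidal transformations, and all modifications between them. An SMC-functor $F:\mathbf B\to\mathbf C$ is a *biequivalence* if there are an SMC-functor $G:\mathbf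 C\to\mathbf B$, an equivalence $FG\simeq 1_{\mathbf C}$ in the bicategory $\mathbf{SMC\text{-}Cat}(\mathbf C,\mathbf C)$, and an equivalence $1_{\mathbf B}\simeq GF$ in the bicategory $\mathbf{SMC\text{-}Cat}(\mathbf B,\mathbf B)$. It is a *local equivalence* if each functor $F:\mathbf B(a,b)\to\mathbf C(Fa,Fb)$ is an equivalence of categories. **Proposition.** An SMC-functor $F:\mathbf B\to\mathbf C$ of SMC-categories is a biequivalence if and only if it is a local equivalence and is surjective up to equivalence on $0$-cells, meaning that every $0$-cell of $\mathbf C$ is equivalent in $\mathbf C$ to $F(b)$ for some $0$-cell $b$ of $\mathbf B$. -/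

import Mathlib

open CategoryTheory

universe w₁ w₂ w₃ v₁ v₂ v₃ u₁ u₂ u₃

section Definitions

open Bicategory MonoidalCategory
open scoped Pseudofunctor.StrongTrans

section Bicategory

variable {B : Type u₁} [Bicategory.{w₁, v₁} B] {a b c d : B}

/-- A 2-cell `g ⟶ g'` as a natural transformation `- ≫ g ⟶ - ≫ g'`. -/
def postcompMap (a : B) {g g' : b ⟶ c} (θ : g ⟶ g') : postcomp a g ⟶ postcomp a g' :=
  (postcomposing a b c).map θ

/-- A 2-cell `f ⟶ f'` as a natural transformation `f ≫ - ⟶ f' ≫ -`. -/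
def precompMap (c : B) {f f' : a ⟶ b} (θ : f ⟶ f') : precomp c f ⟶ precomp c f' :=
  (precomposing a b c).map θ

/-- The associator `(- ≫ g) ≫ h ≅ - ≫ (g ≫ h)`. -/
def postcompAssoc (a : B) (g : b ⟶ c) (h : c ⟶ d) :
    postcomp a g ⋙ postcomp a h ≅ postcomp a (g ≫ h) :=
  associatorNatIsoLeft a g h

/-- The associator `(f ≫ -) ≫ h ≅ f ≫ (- ≫ h)`. -/
def middleAssoc (f : a ⟶ b) (h : c ⟶ d) :
    precomp c f ⋙ postcomp a h ≅ postcomp b h ⋙ precomp d f :=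
  associatorNatIsoMiddle f h

/-- The associator `(f ≫ g) ≫ - ≅ f ≫ (g ≫ -)`. -/
def precompAssoc (f : a ⟶ b) (g : b ⟶ c) (d : B) :
    precomp d (f ≫ g) ≅ precomp d g ⋙ precomp d f :=
  associatorNatIsoRight f g d

/-- The left unitor `𝟙 a ≫ - ≅ -`. -/
def precompUnitor (a b : B) : precomp b (𝟙 a) ≅ 𝟭 (a ⟶ b) :=
  leftUnitorNatIso a b

/-- The right unitor `- ≫ 𝟙 b ≅ -`. -/
def postcompUnitor (a b : B) : postcomp a (𝟙 b) ≅ 𝟭 (a ⟶ b) :=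
  rightUnitorNatIso a b

end Bicategory

/-- An SMC-category: a bicategory `B` with a symmetric monoidal structure `(⊗, 𝟙_)` (the "sum" and
its unit) on every hom-category `a ⟶ b`, such that composition is coherently bilinear.

Composition is written in diagrammatic order: `f ≫ g` is "`g` after `f`". Thus `precomp c f` is the
functor `g ↦ f ≫ g` and `postcomp a g` is the functor `f ↦ f ≫ g`.

* The symmetric strong monoidal structure on the functor `f ↦ (f ≫ -)` into the functor category
  `(b ⟶ c) ⥤ (a ⟶ c)`, whose sum is pointwise, consists of a symmetric strong monoidal structure on
  each of its evaluations `postcomp a g` (`postcompBraided`), natural in `g` (`postcomp_natural`).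
* Symmetrically for `g ↦ (- ≫ g)`, with `precompBraided` and `precomp_natural`. -/
class SMCCategory (B : Type u₁) [Bicategory.{w₁, v₁} B] where
  /-- The monoidal structure on hom-categories. -/
  monoidal (a b : B) : MonoidalCategory (a ⟶ b)
  /-- The monoidal structures are symmetric. -/
  symmetric (a b : B) : SymmetricCategory (a ⟶ b)
  /-- `(f₁ ≫ g) ⊗ (f₂ ≫ g) ≅ (f₁ ⊗ f₂) ≫ g` and `𝟙_ ≅ 𝟙_ ≫ g`. -/
  postcompBraided (a : B) {b c : B} (g : b ⟶ c) : (postcomp a g).Braided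
  /-- `(f ≫ g₁) ⊗ (f ≫ g₂) ≅ f ≫ (g₁ ⊗ g₂)` and `𝟙_ ≅ f ≫ 𝟙_`. -/
  precompBraided {a b : B} (c : B) (f : a ⟶ b) : (precomp c f).Braided
  /-- The isomorphisms of `postcompBraided` are natural in `g`. -/
  postcomp_natural (a : B) {b c : B} {g g' : b ⟶ c} (θ : g ⟶ g') :
    NatTrans.IsMonoidal (postcompMap a θ)
  /-- The isomorphisms of `precompBraided` are natural in `f`. -/
  precomp_natural {a b : B} (c : B) {f f' : a ⟶ b} (θ : f ⟶ f') :
    NatTrans.IsMonoidal (precompMap c θ)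
  /-- The isomorphism `(f₁ ≫ -) ⊗ (f₂ ≫ -) ≅ (f₁ ⊗ f₂) ≫ -` respects sums (the sum of two monoidal
  functors being monoidal through the interchange `tensorμ`). As `tensorμ` is an involution, this
  says equally that `(- ≫ g₁) ⊗ (- ≫ g₂) ≅ - ≫ (g₁ ⊗ g₂)` respects sums. -/
  distrib_distrib {a b c : B} (f₁ f₂ : a ⟶ b) (g₁ g₂ : b ⟶ c) :
    tensorμ (f₁ ≫ g₁) (f₂ ≫ g₁) (f₁ ≫ g₂) (f₂ ≫ g₂) ≫
        (Functor.LaxMonoidal.μ (precomp c f₁) g₁ g₂ ⊗ₘ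
          Functor.LaxMonoidal.μ (precomp c f₂) g₁ g₂) ≫
        Functor.LaxMonoidal.μ (postcomp a (g₁ ⊗ g₂)) f₁ f₂ =
      (Functor.LaxMonoidal.μ (postcomp a g₁) f₁ f₂ ⊗ₘ
          Functor.LaxMonoidal.μ (postcomp a g₂) f₁ f₂) ≫
        Functor.LaxMonoidal.μ (precomp c (f₁ ⊗ f₂)) g₁ g₂
  /-- `(f₁ ≫ -) ⊗ (f₂ ≫ -) ≅ (f₁ ⊗ f₂) ≫ -` respects units; equally, `- ≫ 𝟙_ ≅ 𝟙_` respects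
  sums. -/
  distrib_zero {a b : B} (c : B) (f₁ f₂ : a ⟶ b) :
    (Functor.LaxMonoidal.ε (precomp c f₁) ⊗ₘ Functor.LaxMonoidal.ε (precomp c f₂)) ≫
        Functor.LaxMonoidal.μ (postcomp a (𝟙_ (b ⟶ c))) f₁ f₂ =
      (MonoidalCategory.leftUnitor (𝟙_ (a ⟶ c))).hom ≫
        Functor.LaxMonoidal.ε (precomp c (f₁ ⊗ f₂))
  /-- `(- ≫ g₁) ⊗ (- ≫ g₂) ≅ - ≫ (g₁ ⊗ g₂)` respects units; equally, `𝟙_ ≫ - ≅ 𝟙_` respects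
  sums. -/
  zero_distrib (a : B) {b c : B} (g₁ g₂ : b ⟶ c) :
    (Functor.LaxMonoidal.ε (postcomp a g₁) ⊗ₘ Functor.LaxMonoidal.ε (postcomp a g₂)) ≫
        Functor.LaxMonoidal.μ (precomp c (𝟙_ (a ⟶ b))) g₁ g₂ =
      (MonoidalCategory.leftUnitor (𝟙_ (a ⟶ c))).hom ≫
        Functor.LaxMonoidal.ε (postcomp a (g₁ ⊗ g₂))
  /-- `𝟙_ ≫ - ≅ 𝟙_` (equally, `- ≫ 𝟙_ ≅ 𝟙_`) respects units. -/
  zero_zero (a b c : B) :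
    Functor.LaxMonoidal.ε (postcomp a (𝟙_ (b ⟶ c))) =
      Functor.LaxMonoidal.ε (precomp c (𝟙_ (a ⟶ b)))
  /-- `(- ≫ g) ≫ h ≅ - ≫ (g ≫ h)` is monoidal. -/
  associatorLeft_monoidal (a : B) {b c d : B} (g : b ⟶ c) (h : c ⟶ d) :
    NatTrans.IsMonoidal (postcompAssoc a g h).hom
  /-- `(f ≫ -) ≫ h ≅ f ≫ (- ≫ h)` is monoidal. -/
  associatorMiddle_monoidal {a b c d : B} (f : a ⟶ b) (h : c ⟶ d) :
    NatTrans.IsMonoidal (middleAssoc f h).hom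
  /-- `(f ≫ g) ≫ - ≅ f ≫ (g ≫ -)` is monoidal. -/
  associatorRight_monoidal {a b c : B} (f : a ⟶ b) (g : b ⟶ c) (d : B) :
    NatTrans.IsMonoidal (precompAssoc f g d).hom
  /-- `𝟙 a ≫ - ≅ -` is monoidal. -/
  leftUnitor_monoidal (a b : B) :
    NatTrans.IsMonoidal (precompUnitor a b).hom
  /-- `- ≫ 𝟙 b ≅ -` is monoidal. -/
  rightUnitor_monoidal (a b : B) :
    NatTrans.IsMonoidal (postcompUnitor a b).hom

attribute [reducible, instance] SMCCategory.monoidal SMCCategory.symmetric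
  SMCCategory.postcompBraided SMCCategory.precompBraided

attribute [instance] SMCCategory.postcomp_natural SMCCategory.precomp_natural
  SMCCategory.associatorLeft_monoidal SMCCategory.associatorMiddle_monoidal
  SMCCategory.associatorRight_monoidal SMCCategory.leftUnitor_monoidal
  SMCCategory.rightUnitor_monoidal

section Comparison

variable {B : Type u₁} [Bicategory.{w₁, v₁} B] {C : Type u₂} [Bicategory.{w₂, v₂} C]

/-- The natural isomorphism `F (f ≫ g) ≅ F f ≫ F g` of functors of `g`. -/
def precompComparison (F : B ⥤ᵖ C) {a b : B} (f : a ⟶ b) (c : B) :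
    precomp c f ⋙ F.mapFunctor a c ≅ F.mapFunctor b c ⋙ precomp (F.obj c) (F.map f) :=
  NatIso.ofComponents (fun g => F.mapComp f g) (fun {g g'} θ => by
    have h : F.map₂ (f ◁ θ) ≫ (F.mapComp f g').hom =
      (F.mapComp f g).hom ≫ F.map f ◁ F.map₂ θ := by simp
    exact h)

/-- The natural isomorphism `F (f ≫ g) ≅ F f ≫ F g` of functors of `f`. -/
def postcompComparison (F : B ⥤ᵖ C) (a : B) {b c : B} (g : b ⟶ c) :
    postcomp a g ⋙ F.mapFunctor a c ≅ F.mapFunctor a b ⋙ postcomp (F.obj a) (F.map g) :=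
  NatIso.ofComponents (fun f => F.mapComp f g) (fun {f f'} θ => by
    have h : F.map₂ (θ ▷ g) ≫ (F.mapComp f' g).hom =
      (F.mapComp f g).hom ≫ F.map₂ θ ▷ F.map g := by simp
    exact h)

/-- The natural isomorphism `F f ≫ η_b ≅ η_a ≫ G f` of functors of `f : a ⟶ b`, for a strong
transformation `η : F ⟶ G`. -/
def transComparison {F G : B ⥤ᵖ C} (η : F ⟶ G) (a b : B) :
    F.mapFunctor a b ⋙ postcomp (F.obj a) (η.app b) ≅
      G.mapFunctor a b ⋙ precomp (G.obj b) (η.app a) :=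
  NatIso.ofComponents (fun f => η.naturality f) (fun θ => η.naturality_naturality θ)

end Comparison

/-- An SMC-functor: a pseudofunctor which is symmetric strong monoidal on hom-categories, and whose
compositor `F (f ≫ g) ≅ F f ≫ F g` is a monoidal transformation in each variable. -/
structure SMCFunctor (B : Type u₁) [Bicategory.{w₁, v₁} B] [SMCCategory B]
    (C : Type u₂) [Bicategory.{w₂, v₂} C] [SMCCategory C] extends B ⥤ᵖ C where
  /-- The symmetric strong monoidal structure on `(a ⟶ b) ⥤ (F a ⟶ F b)`. -/
  braided (a b : B) : (toPseudofunctor.mapFunctor a b).Braided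
  precomp_monoidal {a b : B} (f : a ⟶ b) (c : B) :
    NatTrans.IsMonoidal (precompComparison toPseudofunctor f c).hom
  postcomp_monoidal (a : B) {b c : B} (g : b ⟶ c) :
    NatTrans.IsMonoidal (postcompComparison toPseudofunctor a g).hom

attribute [instance] SMCFunctor.braided SMCFunctor.precomp_monoidal SMCFunctor.postcomp_monoidal

/-- Monoidality of a natural transformation depends only on its components. -/
theorem isMonoidal_of_app_eq {C : Type u₁} [Category.{v₁} C] [MonoidalCategory C]
    {D : Type u₂} [Category.{v₂} D] [MonoidalCategory D] {F G : C ⥤ D} [F.LaxMonoidal]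
    [G.LaxMonoidal] {τ : F ⟶ G} (σ : F ⟶ G) (hσ : NatTrans.IsMonoidal σ)
    (h : ∀ X, τ.app X = σ.app X) : NatTrans.IsMonoidal τ := by
  obtain rfl : τ = σ := by ext X; exact h X
  exact hσ

namespace SMCFunctor

/-- The identity SMC-functor. -/
def id (B : Type u₁) [Bicategory.{w₁, v₁} B] [SMCCategory B] : SMCFunctor B B where
  toPseudofunctor := Pseudofunctor.id B
  braided a b := (inferInstance : (𝟭 (a ⟶ b)).Braided)
  precomp_monoidal f c :=
    isMonoidal_of_app_eq (F := precomp c f ⋙ 𝟭 _) (G := 𝟭 _ ⋙ precomp c f)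
      ((precomp c f).rightUnitor.hom ≫ (precomp c f).leftUnitor.inv) inferInstance
      (fun _ => (Category.id_comp _).symm)
  postcomp_monoidal a _ _ g :=
    isMonoidal_of_app_eq (F := postcomp a g ⋙ 𝟭 _) (G := 𝟭 _ ⋙ postcomp a g)
      ((postcomp a g).rightUnitor.hom ≫ (postcomp a g).leftUnitor.inv) inferInstance
      (fun _ => (Category.id_comp _).symm)

variable {B : Type u₁} [Bicategory.{w₁, v₁} B] [SMCCategory B]
  {C : Type u₂} [Bicategory.{w₂, v₂} C] [SMCCategory C]
  {D : Type u₃} [Bicategory.{w₃, v₃} D] [SMCCategory D]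

/-- The composite of SMC-functors, first `F` and then `G`. -/
def comp (F : SMCFunctor B C) (G : SMCFunctor C D) : SMCFunctor B D where
  toPseudofunctor := F.toPseudofunctor.comp G.toPseudofunctor
  braided a b :=
    (inferInstance : (F.mapFunctor a b ⋙ G.mapFunctor (F.obj a) (F.obj b)).Braided)
  precomp_monoidal {a b} f c :=
    isMonoidal_of_app_eq
      (F := precomp c f ⋙ F.mapFunctor a c ⋙ G.mapFunctor (F.obj a) (F.obj c))
      (G := (F.mapFunctor b c ⋙ G.mapFunctor (F.obj b) (F.obj c)) ⋙
        precomp (G.obj (F.obj c)) (G.map (F.map f)))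
      ((Functor.associator _ _ _).inv ≫
        Functor.whiskerRight (precompComparison F.toPseudofunctor f c).hom
          (G.mapFunctor (F.obj a) (F.obj c)) ≫
        (Functor.associator _ _ _).hom ≫
        Functor.whiskerLeft (F.mapFunctor b c)
          (precompComparison G.toPseudofunctor (F.map f) (F.obj c)).hom ≫
        (Functor.associator _ _ _).inv) inferInstance (fun g => by
        simp only [NatTrans.comp_app, Functor.associator_inv_app, Functor.associator_hom_app,
          Category.comp_id, Category.id_comp]
        rfl)
  postcomp_monoidal a {b c} g :=
    isMonoidal_of_app_eq
      (F := postcomp a g ⋙ F.mapFunctor a c ⋙ G.mapFunctor (F.obj a) (F.obj c))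
      (G := (F.mapFunctor a b ⋙ G.mapFunctor (F.obj a) (F.obj b)) ⋙
        postcomp (G.obj (F.obj a)) (G.map (F.map g)))
      ((Functor.associator _ _ _).inv ≫
        Functor.whiskerRight (postcompComparison F.toPseudofunctor a g).hom
          (G.mapFunctor (F.obj a) (F.obj c)) ≫
        (Functor.associator _ _ _).hom ≫
        Functor.whiskerLeft (F.mapFunctor a b)
          (postcompComparison G.toPseudofunctor (F.obj a) (F.map g)).hom ≫
        (Functor.associator _ _ _).inv) inferInstance (fun g => by
        simp only [NatTrans.comp_app, Functor.associator_inv_app, Functor.associator_hom_app,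
          Category.comp_id, Category.id_comp]
        rfl)

end SMCFunctor

/-- A strong monoidal transformation of SMC-functors: a strong transformation of the underlying
pseudofunctors for which `F f ≫ η_b ≅ η_a ≫ G f` is monoidal in `f : a ⟶ b`. -/
structure SMCTrans {B : Type u₁} [Bicategory.{w₁, v₁} B] [SMCCategory B]
    {C : Type u₂} [Bicategory.{w₂, v₂} C] [SMCCategory C] (F G : SMCFunctor B C) where
  toStrongTrans : F.toPseudofunctor ⟶ G.toPseudofunctor
  monoidal (a b : B) : NatTrans.IsMonoidal (transComparison toStrongTrans a b).hom

attribute [instance] SMCTrans.monoidal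

namespace SMCTrans

variable {B : Type u₁} [Bicategory.{w₁, v₁} B] [SMCCategory B]
  {C : Type u₂} [Bicategory.{w₂, v₂} C] [SMCCategory C]

/-- The identity monoidal transformation. -/
def id (F : SMCFunctor B C) : SMCTrans F F where
  toStrongTrans := 𝟙 F.toPseudofunctor
  monoidal a b :=
    isMonoidal_of_app_eq
      (F := F.mapFunctor a b ⋙ postcomp (F.obj a) (𝟙 (F.obj b)))
      (G := F.mapFunctor a b ⋙ precomp (F.obj b) (𝟙 (F.obj a)))
      (Functor.whiskerLeft (F.mapFunctor a b)
        ((postcompUnitor (F.obj a) (F.obj b)).hom ≫ (precompUnitor (F.obj a) (F.obj b)).inv))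
      inferInstance (fun _ => rfl)

/-- The composite of monoidal transformations. -/
def comp {F G H : SMCFunctor B C} (η : SMCTrans F G) (θ : SMCTrans G H) : SMCTrans F H where
  toStrongTrans := η.toStrongTrans ≫ θ.toStrongTrans
  monoidal a b :=
    isMonoidal_of_app_eq
      (F := F.mapFunctor a b ⋙
        postcomp (F.obj a) (η.toStrongTrans.app b ≫ θ.toStrongTrans.app b))
      (G := H.mapFunctor a b ⋙
        precomp (H.obj b) (η.toStrongTrans.app a ≫ θ.toStrongTrans.app a))
      (Functor.whiskerLeft _
          (postcompAssoc (F.obj a) (η.toStrongTrans.app b) (θ.toStrongTrans.app b)).inv ≫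
        (Functor.associator _ _ _).inv ≫
        Functor.whiskerRight (transComparison η.toStrongTrans a b).hom _ ≫
        (Functor.associator _ _ _).hom ≫
        Functor.whiskerLeft _
          (middleAssoc (η.toStrongTrans.app a) (θ.toStrongTrans.app b)).hom ≫
        (Functor.associator _ _ _).inv ≫
        Functor.whiskerRight (transComparison θ.toStrongTrans a b).hom _ ≫
        (Functor.associator _ _ _).hom ≫
        Functor.whiskerLeft _
          (precompAssoc (η.toStrongTrans.app a) (θ.toStrongTrans.app a) (H.obj b)).inv)
      (by
        repeat' refine @NatTrans.IsMonoidal.comp _ _ _ _ _ _ _ _ _ _ _ _ _ _ ?_ ?_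
        all_goals infer_instance) (fun f => by
        simp only [NatTrans.comp_app, Functor.associator_inv_app, Functor.associator_hom_app,
          Category.id_comp]
        rfl)

end SMCTrans

section SMCCat

variable {B : Type u₁} [Bicategory.{w₁, v₁} B] [SMCCategory B]
  {C : Type u₂} [Bicategory.{w₂, v₂} C] [SMCCategory C]

/-- Monoidal transformations and (all) modifications between them form a category. -/
instance SMCTrans.category (F G : SMCFunctor B C) : Category (SMCTrans F G) where
  Hom η θ := η.toStrongTrans ⟶ θ.toStrongTrans
  id η := 𝟙 η.toStrongTrans
  comp Γ Γ₁ := Γ ≫ Γ₁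
  id_comp Γ := Category.id_comp Γ
  comp_id Γ := Category.comp_id Γ
  assoc Γ Γ₁ Γ₂ := Category.assoc Γ Γ₁ Γ₂

/-- An invertible modification gives an isomorphism of monoidal transformations. -/
def SMCTrans.isoMk {F G : SMCFunctor B C} {η θ : SMCTrans F G}
    (e : η.toStrongTrans ≅ θ.toStrongTrans) : η ≅ θ where
  hom := e.hom
  inv := e.inv
  hom_inv_id := e.hom_inv_id
  inv_hom_id := e.inv_hom_id

/-- Left whiskering of a modification by a monoidal transformation. -/
def SMCTrans.whiskerLeft {F G H : SMCFunctor B C} (η : SMCTrans F G) {θ ι : SMCTrans G H}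
    (Γ : θ ⟶ ι) : η.comp θ ⟶ η.comp ι :=
  η.toStrongTrans ◁ (show θ.toStrongTrans ⟶ ι.toStrongTrans from Γ)

/-- Right whiskering of a modification by a monoidal transformation. -/
def SMCTrans.whiskerRight {F G H : SMCFunctor B C} {η θ : SMCTrans F G} (Γ : η ⟶ θ)
    (ι : SMCTrans G H) : η.comp ι ⟶ θ.comp ι :=
  (show η.toStrongTrans ⟶ θ.toStrongTrans from Γ) ▷ ι.toStrongTrans

/-- The bicategory `SMC-Cat(B, C)` of SMC-functors, strong monoidal transformations and
modifications, with all operations those of the bicategory of pseudofunctors. -/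
instance SMCFunctor.bicategory : Bicategory (SMCFunctor B C) where
  Hom F G := SMCTrans F G
  id F := SMCTrans.id F
  comp η θ := η.comp θ
  homCategory F G := SMCTrans.category F G
  whiskerLeft η θ ι Γ := SMCTrans.whiskerLeft η (θ := θ) (ι := ι) Γ
  whiskerRight {_ _ _ η θ} Γ ι := SMCTrans.whiskerRight (η := η) (θ := θ) Γ ι
  associator η θ ι :=
    SMCTrans.isoMk (α_ η.toStrongTrans θ.toStrongTrans ι.toStrongTrans)
  leftUnitor η := SMCTrans.isoMk (λ_ η.toStrongTrans)
  rightUnitor η := SMCTrans.isoMk (ρ_ η.toStrongTrans)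
  whiskerLeft_id η θ := Bicategory.whiskerLeft_id η.toStrongTrans θ.toStrongTrans
  whiskerLeft_comp η _ _ _ Γ Γ₁ := Bicategory.whiskerLeft_comp η.toStrongTrans Γ Γ₁
  id_whiskerLeft {_ _ η θ} Γ :=
    Bicategory.id_whiskerLeft (f := η.toStrongTrans) (g := θ.toStrongTrans) Γ
  comp_whiskerLeft η θ _ _ Γ :=
    Bicategory.comp_whiskerLeft η.toStrongTrans θ.toStrongTrans Γ
  id_whiskerRight η θ := Bicategory.id_whiskerRight η.toStrongTrans θ.toStrongTrans
  comp_whiskerRight Γ Γ₁ η := Bicategory.comp_whiskerRight Γ Γ₁ η.toStrongTrans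
  whiskerRight_id {_ _ η θ} Γ :=
    Bicategory.whiskerRight_id (f := η.toStrongTrans) (g := θ.toStrongTrans) Γ
  whiskerRight_comp Γ θ ι := Bicategory.whiskerRight_comp Γ θ.toStrongTrans ι.toStrongTrans
  whisker_assoc η _ _ Γ ι := Bicategory.whisker_assoc η.toStrongTrans Γ ι.toStrongTrans
  whisker_exchange {_ _ _ η θ ι κ} Γ Γ₁ :=
    Bicategory.whisker_exchange (f := η.toStrongTrans) (g := θ.toStrongTrans)
      (h := ι.toStrongTrans) (i := κ.toStrongTrans) Γ Γ₁
  pentagon η θ ι κ :=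
    Bicategory.pentagon η.toStrongTrans θ.toStrongTrans ι.toStrongTrans κ.toStrongTrans
  triangle η θ := Bicategory.triangle η.toStrongTrans θ.toStrongTrans

end SMCCat

namespace SMCFunctor

variable {B : Type u₁} [Bicategory.{w₁, v₁} B] [SMCCategory B]
  {C : Type u₂} [Bicategory.{w₂, v₂} C] [SMCCategory C]

/-- `F : B → C` is a biequivalence if there are an SMC-functor `G : C → B`, an equivalence between
"`F` after `G`" and the identity in `SMC-Cat(C, C)`, and an equivalence between the identity and
"`G` after `F`" in `SMC-Cat(B, B)`. -/
def IsBiequivalence (F : SMCFunctor B C) : Prop :=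
  ∃ G : SMCFunctor C B,
    Nonempty (Bicategory.Equivalence (G.comp F) (SMCFunctor.id C)) ∧
      Nonempty (Bicategory.Equivalence (SMCFunctor.id B) (F.comp G))

/-- `F` is a local equivalence if each functor `(a ⟶ b) ⥤ (F a ⟶ F b)` is an equivalence. -/
def IsLocalEquivalence (F : SMCFunctor B C) : Prop :=
  ∀ a b : B, (F.mapFunctor a b).IsEquivalence

/-- `F` is surjective up to equivalence on `0`-cells: every `0`-cell of `C` is equivalent, in the
bicategory `C`, to some `F b`. -/
def IsEssSurjOnZeroCells (F : SMCFunctor B C) : Prop :=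
  ∀ c : C, ∃ b : B, Nonempty (Bicategory.Equivalence (F.obj b) c)

end SMCFunctor

end Definitions

/-! Necessity: the components of an equivalence of SMC-functors are equivalences, so its naturality
squares show that a functor equivalent to a local equivalence is one
(`IsLocalEquivalence.of_equivalence`). Both composites of `F` with its inverse `G` are therefore
local equivalences, and two-out-of-six on hom-categories gives the claim for `F`. The component at
`c` of the equivalence from `G.comp F` to the identity gives surjectivity.

Sufficiency: choose equivalences `e c : F (obj c) ≌ c`. Then `g ↦ F g ≫ e d` is a braided
equivalence of hom-categories, and `G f` is the preimage of `e c ≫ f` under it. Full faithfulness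
forces the coherence cells of `G` and reduces their axioms to identities in `C`
(`InverseData.hom_ext`); monoidality is likewise reflected by a faithful monoidal functor
(`isMonoidal_of_map_comp_eq`). By construction the `e c` form a monoidal transformation from `G.comp
F` to the identity. A monoidal transformation with equivalences as components is an equivalence in
the bicategory of SMC-functors (`SMCTrans.nonempty_equivalence`), since its inverse is obtained by
cancelling it from an identity. For the other composite, restrict `e` along `F` and lift the result
through `F`, which is locally fully faithful (`SMCTrans.lift`). -/

/-! ### Reflecting monoidality, and inverses of braided equivalences -/

section MonoidalTransfer

open MonoidalCategory

variable {C : Type u₁} [Category.{v₁} C] [MonoidalCategory C]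
  {D : Type u₂} [Category.{v₂} D] [MonoidalCategory D]
  {E : Type u₃} [Category.{v₃} E] [MonoidalCategory E]

/-- Instance with explicit hypotheses, so that long pastings can be split factor by factor. -/
theorem isMonoidal_comp {F G H : C ⥤ D} [F.LaxMonoidal] [G.LaxMonoidal] [H.LaxMonoidal]
    {σ : F ⟶ G} {τ : G ⟶ H} (hσ : NatTrans.IsMonoidal σ) (hτ : NatTrans.IsMonoidal τ) :
    NatTrans.IsMonoidal (σ ≫ τ) :=
  inferInstance

theorem isMonoidal_whiskerLeft (F : C ⥤ D) [F.LaxMonoidal] {G H : D ⥤ E} [G.LaxMonoidal]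
    [H.LaxMonoidal] {τ : G ⟶ H} (hτ : NatTrans.IsMonoidal τ) :
    NatTrans.IsMonoidal (Functor.whiskerLeft F τ) :=
  inferInstance

/-- Monoidality of a transformation is detected by faithful monoidal functors. -/
theorem isMonoidal_of_whiskerRight {F G : C ⥤ D} [F.LaxMonoidal] [G.LaxMonoidal] (τ : F ⟶ G)
    (K : D ⥤ E) [K.Monoidal] [K.Faithful]
    (h : NatTrans.IsMonoidal (Functor.whiskerRight τ K)) : NatTrans.IsMonoidal τ where
  unit := K.map_injective (by
    have := h.unit
    simp only [Functor.LaxMonoidal.comp_ε, Functor.whiskerRight_app, Category.assoc] at this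
    -- `K` is strong, so its unit constraint is invertible and cancels; below, the same holds for
    -- its tensor constraint.
    rw [cancel_epi, ← K.map_comp] at this
    exact this)
  tensor X Y := K.map_injective (by
    have := h.tensor X Y
    simp only [Functor.LaxMonoidal.comp_μ, Functor.whiskerRight_app, Category.assoc,
      Functor.LaxMonoidal.μ_natural_assoc] at this
    rw [cancel_epi, ← K.map_comp, ← K.map_comp] at this
    exact this)

/-- A natural transformation is monoidal if its composite with an invertible
monoidal transformation is. -/
theorem isMonoidal_of_comp_isIso {F F' G : C ⥤ D} [F.LaxMonoidal] [F'.LaxMonoidal]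
    [G.LaxMonoidal] (τ : F ⟶ F') (ρ : F' ⟶ G) [IsIso ρ] (hρ : NatTrans.IsMonoidal ρ)
    (h : NatTrans.IsMonoidal (τ ≫ ρ)) : NatTrans.IsMonoidal τ := by
  have hτ : τ = (τ ≫ ρ) ≫ (asIso ρ).inv := by simp
  have : NatTrans.IsMonoidal (asIso ρ).hom := hρ
  rw [hτ]
  infer_instance

/-- A transformation `τ` is monoidal if `K.map τ ≫ ρ = κ` for a faithful monoidal functor `K`,
an invertible monoidal `ρ` and a monoidal `κ`. -/
theorem isMonoidal_of_map_comp_eq {F F' : C ⥤ D} {G : C ⥤ E} [F.LaxMonoidal] [F'.LaxMonoidal]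
    [G.LaxMonoidal] (τ : F ⟶ F') (K : D ⥤ E) [K.Monoidal] [K.Faithful] (ρ : F' ⋙ K ⟶ G) [IsIso ρ]
    (hρ : NatTrans.IsMonoidal ρ) (κ : F ⋙ K ⟶ G) (hκ : NatTrans.IsMonoidal κ)
    (h : ∀ X, K.map (τ.app X) ≫ ρ.app X = κ.app X) : NatTrans.IsMonoidal τ := by
  refine isMonoidal_of_whiskerRight τ K (isMonoidal_of_comp_isIso _ ρ hρ ?_)
  obtain rfl : Functor.whiskerRight τ K ≫ ρ = κ := by
    ext X
    exact h X
  exact hκ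

/-- The structure on the inverse is the mate of the one on the functor, so compatibility is
definitional. -/
theorem isMonoidal_inverseMonoidal (e : C ≌ D) [e.functor.Monoidal] :
    letI := e.inverseMonoidal
    e.IsMonoidal :=
  letI := e.inverseMonoidal
  { leftAdjoint_ε := rfl
    leftAdjoint_μ := fun _ _ => rfl }

variable [BraidedCategory C] [BraidedCategory D]

/-- The inverse of a braided monoidal equivalence is braided monoidal. -/
@[reducible]
noncomputable def braidedInverse (e : C ≌ D) [e.functor.Braided] : e.inverse.Braided :=
  letI : e.inverse.Monoidal := e.inverseMonoidal
  haveI : e.IsMonoidal := isMonoidal_inverseMonoidal e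
  { braided X Y := e.functor.map_injective (by
      -- Tested after applying `e.functor` and the invertible counit, the claim becomes naturality
      -- of the braiding of `D`.
      rw [← cancel_mono (e.counit.app _), e.functor.map_comp, e.functor.map_comp,
        Functor.map_braiding e.functor]
      simp only [Category.assoc, e.functor_map_μ_inverse_comp_counit_app_tensor]
      simp [e.functor_map_μ_inverse_comp_counit_app_tensor_assoc]) }

theorem isMonoidal_counit (e : C ≌ D) [e.functor.Braided] :
    letI := braidedInverse e
    NatTrans.IsMonoidal e.counit := by
  let : e.inverse.Monoidal := e.inverseMonoidal
  have : e.IsMonoidal := isMonoidal_inverseMonoidal e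
  exact inferInstanceAs (NatTrans.IsMonoidal e.toAdjunction.counit)

end MonoidalTransfer

/-! ### Equivalences inside a bicategory -/

section EquivalenceCells

open Bicategory

variable {B : Type u₁} [Bicategory.{w₁, v₁} B] {a b c d : B}

/-- Postcomposition with an equivalence is an equivalence of hom-categories. -/
def postcompEquivalence (a : B) (e : b ≌ c) : (a ⟶ b) ≌ (a ⟶ c) :=
  CategoryTheory.Equivalence.mk (postcomp a e.hom) (postcomp a e.inv)
    ((postcompUnitor a b).symm ≪≫ (postcomposing a b b).mapIso e.unit ≪≫
      (postcompAssoc a e.hom e.inv).symm)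
    (postcompAssoc a e.inv e.hom ≪≫ (postcomposing a c c).mapIso e.counit ≪≫ postcompUnitor a c)

/-- Precomposition with an equivalence is an equivalence of hom-categories. -/
def precompEquivalence (e : a ≌ b) (c : B) : (b ⟶ c) ≌ (a ⟶ c) :=
  CategoryTheory.Equivalence.mk (precomp c e.hom) (precomp c e.inv)
    -- Precomposition reverses 1-cells, so the counit of `e` yields the unit here: `g ≅ 𝟙 b ≫ g ≅
    -- (e.inv ≫ e.hom) ≫ g`.
    ((precompUnitor b c).symm ≪≫ (precomposing b b c).mapIso e.counit.symm ≪≫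
      (precompAssoc e.inv e.hom c))
    ((precompAssoc e.hom e.inv c).symm ≪≫ (precomposing a a c).mapIso e.unit.symm ≪≫
      precompUnitor a c)

theorem isEquivalence_postcomp (a : B) (e : b ≌ c) : (postcomp a e.hom).IsEquivalence :=
  (postcompEquivalence a e).isEquivalence_functor

theorem isEquivalence_precomp (e : a ≌ b) (c : B) : (precomp c e.hom).IsEquivalence :=
  (precompEquivalence e c).isEquivalence_functor

/-- A 1-cell with a right inverse which itself has a right inverse is an equivalence. -/
def equivalenceOfRightInverses (f : a ⟶ b) (g : b ⟶ a) (h : a ⟶ b) (u : f ≫ g ≅ 𝟙 a)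
    (v : g ≫ h ≅ 𝟙 b) : a ≌ b :=
  Equivalence.mkOfAdjointifyCounit u.symm
    -- `f ≅ f ≫ g ≫ h ≅ h`, so the right inverse `h` of `g` may be replaced by `f`.
    (whiskerLeftIso g ((ρ_ f).symm ≪≫ whiskerLeftIso f v.symm ≪≫ (α_ f g h).symm ≪≫
      whiskerRightIso u h ≪≫ λ_ h) ≪≫ v)

instance (a : B) {g g' : b ⟶ c} (θ : g ⟶ g') [IsIso θ] : IsIso (postcompMap a θ) :=
  inferInstanceAs (IsIso ((postcomposing a b c).map θ))

instance (c : B) {f f' : a ⟶ b} (θ : f ⟶ f') [IsIso θ] : IsIso (precompMap c θ) :=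
  inferInstanceAs (IsIso ((precomposing a b c).map θ))

/-- The inverse equivalence. -/
def equivalenceSymm (e : a ≌ b) : b ≌ a :=
  Equivalence.mkOfAdjointifyCounit e.counit.symm e.unit.symm

end EquivalenceCells

/-! ### Calculus of squares over a pseudofunctor -/

section Squares

open Bicategory

variable {B : Type u₁} [Bicategory.{w₁, v₁} B] {C : Type u₂} [Bicategory.{w₂, v₂} C]
  (F : B ⥤ᵖ C) {x y z w : B} {a b c d : C} {p : F.obj x ⟶ a} {q : F.obj y ⟶ b}
  {r : F.obj z ⟶ c} {s : F.obj w ⟶ d}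

/-- A 2-cell `β` of `B` and a 2-cell `γ` of `C` form a morphism between squares filled by
`σ` and `σ'`. -/
def SquareHom {g g' : x ⟶ y} {f f' : a ⟶ b} (σ : F.map g ≫ q ≅ p ≫ f)
    (σ' : F.map g' ≫ q ≅ p ≫ f') (β : g ⟶ g') (γ : f ⟶ f') : Prop :=
  F.map₂ β ▷ q ≫ σ'.hom = σ.hom ≫ p ◁ γ

/-- The identity square. -/
def idSquare (p : F.obj x ⟶ a) : F.map (𝟙 x) ≫ p ≅ p ≫ 𝟙 a :=
  whiskerRightIso (F.mapId _) _ ≪≫ λ_ _ ≪≫ (ρ_ _).symm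

/-- The composite of squares. -/
def compSquare {g : x ⟶ y} {h : y ⟶ z} {f : a ⟶ b} {k : b ⟶ c} (σ : F.map g ≫ q ≅ p ≫ f)
    (τ : F.map h ≫ r ≅ q ≫ k) : F.map (g ≫ h) ≫ r ≅ p ≫ f ≫ k :=
  whiskerRightIso (F.mapComp _ _) _ ≪≫ α_ _ _ _ ≪≫ whiskerLeftIso _ τ ≪≫
    (α_ _ _ _).symm ≪≫ whiskerRightIso σ k ≪≫ α_ _ _ _

namespace SquareHom

variable {F}

/-- This and the following closure properties exhibit a composite 2-cell of `B` as lying over the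
corresponding composite in `C`, so coherence laws can be compared in `C`. -/
theorem comp {g g' g'' : x ⟶ y} {f f' f'' : a ⟶ b} {σ : F.map g ≫ q ≅ p ≫ f}
    {σ' : F.map g' ≫ q ≅ p ≫ f'} {σ'' : F.map g'' ≫ q ≅ p ≫ f''} {β : g ⟶ g'} {γ : f ⟶ f'}
    {β' : g' ⟶ g''} {γ' : f' ⟶ f''} (h : SquareHom F σ σ' β γ) (h' : SquareHom F σ' σ'' β' γ') :
    SquareHom F σ σ'' (β ≫ β') (γ ≫ γ') := by
  dsimp only [SquareHom] at *
  rw [F.map₂_comp, comp_whiskerRight, Category.assoc, h', reassoc_of% h, whiskerLeft_comp]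

theorem inv {g g' : x ⟶ y} {f f' : a ⟶ b} {σ : F.map g ≫ q ≅ p ≫ f}
    {σ' : F.map g' ≫ q ≅ p ≫ f'} {β : g ≅ g'} {γ : f ≅ f'}
    (h : SquareHom F σ σ' β.hom γ.hom) : SquareHom F σ' σ β.inv γ.inv := by
  dsimp only [SquareHom] at *
  rw [← cancel_mono (p ◁ γ.hom), Category.assoc, ← h]
  simp [← comp_whiskerRight_assoc, ← F.map₂_comp]

theorem whiskerLeft {g : x ⟶ y} {h h' : y ⟶ z} {f : a ⟶ b} {k k' : b ⟶ c}
    (σ : F.map g ≫ q ≅ p ≫ f) {τ : F.map h ≫ r ≅ q ≫ k} {τ' : F.map h' ≫ r ≅ q ≫ k'}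
    {β : h ⟶ h'} {γ : k ⟶ k'} (H : SquareHom F τ τ' β γ) :
    SquareHom F (compSquare F σ τ) (compSquare F σ τ') (g ◁ β) (f ◁ γ) := by
  have h₁ := congrArg (F.map g ◁ ·) H
  simp only [whiskerLeft_comp] at h₁
  simp only [SquareHom, compSquare]
  simp [reassoc_of% h₁]
  rw [associator_inv_naturality_right_assoc, whisker_exchange_assoc]
  simp

theorem whiskerRight {g g' : x ⟶ y} {h : y ⟶ z} {f f' : a ⟶ b} {k : b ⟶ c}
    {σ : F.map g ≫ q ≅ p ≫ f} {σ' : F.map g' ≫ q ≅ p ≫ f'} (τ : F.map h ≫ r ≅ q ≫ k)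
    {β : g ⟶ g'} {γ : f ⟶ f'} (H : SquareHom F σ σ' β γ) :
    SquareHom F (compSquare F σ τ) (compSquare F σ' τ) (β ▷ h) (γ ▷ k) := by
  have h₁ := congrArg (· ▷ k) H
  simp only [comp_whiskerRight, whisker_assoc] at h₁
  simp only [SquareHom, compSquare]
  simp
  rw [associator_naturality_left_assoc, ← whisker_exchange_assoc,
    associator_inv_naturality_left_assoc, reassoc_of% h₁]
  simp

theorem associator {g : x ⟶ y} {h : y ⟶ z} {i : z ⟶ w} {f : a ⟶ b} {k : b ⟶ c} {l : c ⟶ d}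
    (σ : F.map g ≫ q ≅ p ≫ f) (τ : F.map h ≫ r ≅ q ≫ k) (υ : F.map i ≫ s ≅ r ≫ l) :
    SquareHom F (compSquare F (compSquare F σ τ) υ) (compSquare F σ (compSquare F τ υ))
      (α_ g h i).hom (α_ f k l).hom := by
  simp only [SquareHom, compSquare]
  simp
  rw [← associator_inv_naturality_left_assoc, whisker_exchange_assoc,
    ← associator_naturality_left_assoc]
  simp

theorem leftUnitor {g : x ⟶ y} {f : a ⟶ b} (σ : F.map g ≫ q ≅ p ≫ f) :
    SquareHom F (compSquare F (idSquare F p) σ) σ (λ_ g).hom (λ_ f).hom := by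
  simp only [SquareHom, compSquare, idSquare]
  simp
  rw [← associator_inv_naturality_left_assoc, whisker_exchange_assoc,
    ← associator_naturality_left_assoc]
  simp

theorem rightUnitor {g : x ⟶ y} {f : a ⟶ b} (σ : F.map g ≫ q ≅ p ≫ f) :
    SquareHom F (compSquare F σ (idSquare F q)) σ (ρ_ g).hom (ρ_ f).hom := by
  simp only [SquareHom, compSquare, idSquare]
  simp

end SquareHom

end Squares

/-! ### The inverse pseudofunctor and its counit -/

section InverseData

open Bicategory
open scoped Pseudofunctor.StrongTrans

/-- Data from which a pseudofunctor `C ⥤ᵖ B` in the opposite direction to `F` can be built,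
together with a strong transformation from its composite with `F` to the identity. -/
structure InverseData {B : Type u₁} [Bicategory.{w₁, v₁} B] {C : Type u₂} [Bicategory.{w₂, v₂} C]
    (F : B ⥤ᵖ C) where
  /-- The action on 0-cells. -/
  obj : C → B
  /-- The components of the transformation. -/
  app (c : C) : F.obj (obj c) ⟶ c
  /-- The action on hom-categories. -/
  functor (c d : C) : (c ⟶ d) ⥤ (obj c ⟶ obj d)
  /-- The naturality isomorphisms of the transformation. -/
  square (c d : C) : functor c d ⋙ F.mapFunctor (obj c) (obj d) ⋙ postcomp (F.obj (obj c)) (app d) ≅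
    precomp d (app c)
  full (x : B) (d : C) : (F.mapFunctor x (obj d) ⋙ postcomp (F.obj x) (app d)).Full
  faithful (x : B) (d : C) : (F.mapFunctor x (obj d) ⋙ postcomp (F.obj x) (app d)).Faithful

namespace InverseData

variable {B : Type u₁} [Bicategory.{w₁, v₁} B] {C : Type u₂} [Bicategory.{w₂, v₂} C]
  {F : B ⥤ᵖ C} (S : InverseData F)

attribute [instance] full faithful

/-- The naturality squares. -/
def sq {c d : C} (f : c ⟶ d) : F.map ((S.functor c d).obj f) ≫ S.app d ≅ S.app c ≫ f :=
  (S.square c d).app f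

variable {S} in
-- Faithfulness of `g ↦ F g ≫ S.app d`, with `σ'` invertible, leaves at most one 2-cell over a given
-- 2-cell of `C`. The default `simp` proof covers the usual case, where the 2-cells of `C` agree by
-- a bicategory axiom.
theorem hom_ext {x : B} {c d : C} {p : F.obj x ⟶ c} {g g' : x ⟶ S.obj d} {f f' : c ⟶ d}
    {σ : F.map g ≫ S.app d ≅ p ≫ f} {σ' : F.map g' ≫ S.app d ≅ p ≫ f'} {α β : g ⟶ g'}
    {γ δ : f ⟶ f'} (h : SquareHom F σ σ' α γ) (h' : SquareHom F σ σ' β δ)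
    (e : γ = δ := by simp) : α = β := by
  subst e
  exact (F.mapFunctor x (S.obj d) ⋙ postcomp (F.obj x) (S.app d)).map_injective
    ((cancel_mono σ'.hom).1 (h.trans h'.symm))

/-- The isomorphism in `B` between two 1-cells filling squares with the same sides. -/
noncomputable def fillerIso {x : B} {c d : C} {p : F.obj x ⟶ c} {g g' : x ⟶ S.obj d} {f : c ⟶ d}
    (σ : F.map g ≫ S.app d ≅ p ≫ f) (σ' : F.map g' ≫ S.app d ≅ p ≫ f) : g ≅ g' :=
  (F.mapFunctor x (S.obj d) ⋙ postcomp (F.obj x) (S.app d)).preimageIso (σ ≪≫ σ'.symm)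

theorem squareHom_fillerIso {x : B} {c d : C} {p : F.obj x ⟶ c} {g g' : x ⟶ S.obj d} {f : c ⟶ d}
    (σ : F.map g ≫ S.app d ≅ p ≫ f) (σ' : F.map g' ≫ S.app d ≅ p ≫ f) :
    SquareHom F σ σ' (S.fillerIso σ σ').hom (𝟙 f) := by
  have h := (F.mapFunctor x (S.obj d) ⋙ postcomp (F.obj x) (S.app d)).map_preimage
    (σ ≪≫ σ'.symm).hom
  change F.map₂ (S.fillerIso σ σ').hom ▷ S.app d = _ at h
  simp [SquareHom, h]

theorem squareHom_fillerIso_inv {x : B} {c d : C} {p : F.obj x ⟶ c} {g g' : x ⟶ S.obj d}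
    {f : c ⟶ d} (σ : F.map g ≫ S.app d ≅ p ≫ f) (σ' : F.map g' ≫ S.app d ≅ p ≫ f) :
    SquareHom F σ' σ (S.fillerIso σ σ').inv (𝟙 f) :=
  SquareHom.inv (γ := Iso.refl f) (S.squareHom_fillerIso σ σ')

theorem squareHom_map {c d : C} {f f' : c ⟶ d} (θ : f ⟶ f') :
    SquareHom F (S.sq f) (S.sq f') ((S.functor c d).map θ) θ :=
  (S.square c d).hom.naturality θ

/-- The pseudofunctor inverse to `F`. -/
noncomputable def pseudofunctor : C ⥤ᵖ B where
  obj := S.obj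
  map f := (S.functor _ _).obj f
  map₂ θ := (S.functor _ _).map θ
  map₂_id f := (S.functor _ _).map_id f
  map₂_comp η θ := (S.functor _ _).map_comp η θ
  -- The image of an identity or composite and the identity or composite of images fill squares with
  -- the same sides, hence are canonically isomorphic.
  mapId c := S.fillerIso (S.sq (𝟙 c)) (idSquare F (S.app c))
  mapComp f g := S.fillerIso (S.sq (f ≫ g)) (compSquare F (S.sq f) (S.sq g))
  -- For each axiom, both sides are exhibited over equal 2-cells of `C`; the fillers lie over
  -- identities.
  map₂_whisker_left _ _ _ η := hom_ext (S.squareHom_map _)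
    ((S.squareHom_fillerIso _ _).comp
      (((S.squareHom_map η).whiskerLeft (S.sq _)).comp (S.squareHom_fillerIso_inv _ _)))
  map₂_whisker_right η h := hom_ext (S.squareHom_map _)
    ((S.squareHom_fillerIso _ _).comp
      (((S.squareHom_map η).whiskerRight (S.sq _)).comp (S.squareHom_fillerIso_inv _ _)))
  map₂_associator f g h := hom_ext (S.squareHom_map _)
    ((S.squareHom_fillerIso _ _).comp
      (((S.squareHom_fillerIso _ _).whiskerRight (S.sq h)).comp
        ((SquareHom.associator (S.sq f) (S.sq g) (S.sq h)).comp
          (((S.squareHom_fillerIso_inv _ _).whiskerLeft (S.sq f)).comp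
            (S.squareHom_fillerIso_inv _ _)))))
  map₂_left_unitor f := hom_ext (S.squareHom_map _)
    ((S.squareHom_fillerIso _ _).comp
      (((S.squareHom_fillerIso _ _).whiskerRight (S.sq f)).comp (SquareHom.leftUnitor (S.sq f))))
  map₂_right_unitor f := hom_ext (S.squareHom_map _)
    ((S.squareHom_fillerIso _ _).comp
      (((S.squareHom_fillerIso _ _).whiskerLeft (S.sq f)).comp (SquareHom.rightUnitor (S.sq f))))

/-- The strong transformation from the composite of the inverse with `F` to the identity. -/
noncomputable def counit : S.pseudofunctor.comp F ⟶ Pseudofunctor.id C where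
  app := S.app
  naturality f := S.sq f
  naturality_naturality θ := S.squareHom_map θ
  naturality_id c := by
    -- The unit and composition axioms are the defining properties of the fillers chosen as `mapId`
    -- and `mapComp`.
    have h := S.squareHom_fillerIso (S.sq (𝟙 c)) (idSquare F (S.app c))
    simp only [SquareHom, idSquare, Iso.trans_hom, whiskerRightIso_hom, Iso.symm_hom,
      ← comp_whiskerRight_assoc] at h
    exact h.symm
  naturality_comp f g := by
    have h := S.squareHom_fillerIso (S.sq (f ≫ g)) (compSquare F (S.sq f) (S.sq g))
    simp only [SquareHom, compSquare, Iso.trans_hom, whiskerRightIso_hom, whiskerLeftIso_hom,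
      Iso.symm_hom, ← comp_whiskerRight_assoc] at h
    exact h.symm

end InverseData

end InverseData

/-! ### Monoidality of the inverse and its counit -/

section InverseSMCFunctor

open Bicategory
open scoped Pseudofunctor.StrongTrans

variable {B : Type u₁} [Bicategory.{w₁, v₁} B] [SMCCategory B]
  {C : Type u₂} [Bicategory.{w₂, v₂} C] [SMCCategory C]

/-- Inverse data for an SMC-functor in which everything is braided monoidal. -/
structure SMCInverseData (F : SMCFunctor B C) extends InverseData F.toPseudofunctor where
  braided (c d : C) : (functor c d).Braided
  square_monoidal (c d : C) : NatTrans.IsMonoidal (square c d).hom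

namespace SMCInverseData

attribute [instance] braided square_monoidal

variable {F : SMCFunctor B C} (S : SMCInverseData F)

/-- The compositor is a preimage under the faithful monoidal functor `F.mapFunctor _ _ ⋙ postcomp _
(S.app c)`. Its image relates the square of `f ≫ g` to the pasting of those of `f` and `g`, both
monoidal in `g`; the fixed square of `f` enters through `precompMap`, whence naturality of the
bilinearity constraints. -/
theorem precompComparison_monoidal {a b : C} (f : a ⟶ b) (c : C) :
    NatTrans.IsMonoidal (F₁ := precomp c f ⋙ S.functor a c)
      (F₂ := S.functor b c ⋙ precomp (S.obj c) ((S.functor a b).obj f))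
      (precompComparison S.pseudofunctor f c).hom := by
  refine isMonoidal_of_map_comp_eq _ (F.mapFunctor (S.obj a) (S.obj c) ⋙ postcomp _ (S.app c))
    ((Functor.associator _ _ _).hom ≫ Functor.whiskerLeft (S.functor b c)
      ((Functor.associator _ _ _).inv ≫
        Functor.whiskerRight (precompComparison F.toPseudofunctor ((S.functor a b).obj f) _).hom _ ≫
        (Functor.associator _ _ _).hom ≫
        Functor.whiskerLeft _ (middleAssoc (F.map ((S.functor a b).obj f)) (S.app c)).hom ≫
        (Functor.associator _ _ _).inv) ≫
      (Functor.associator _ _ _).inv ≫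
      Functor.whiskerRight (S.square b c).hom _ ≫
      (precompAssoc _ _ _).inv ≫ precompMap c (S.sq f).hom ≫ (precompAssoc _ _ _).hom) ?_
    ((Functor.associator _ _ _).hom ≫ Functor.whiskerLeft (precomp c f) (S.square a c).hom) ?_ ?_
  · repeat' refine isMonoidal_comp ?_ ?_
    all_goals infer_instance
  · infer_instance
  · intro g
    have h := S.squareHom_fillerIso (S.sq (f ≫ g)) (compSquare _ (S.sq f) (S.sq g))
    rw [SquareHom, whiskerLeft_id, Category.comp_id] at h
    simp only [NatTrans.comp_app, Functor.whiskerLeft_app, Functor.associator_hom_app,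
      Functor.associator_inv_app, Category.id_comp, Category.comp_id, Category.assoc]
    exact h

/-- The same pasting, read as a transformation in `f`; now the square of `g` is the fixed one and
enters through `postcompMap`. -/
theorem postcompComparison_monoidal (a : C) {b c : C} (g : b ⟶ c) :
    NatTrans.IsMonoidal (F₁ := postcomp a g ⋙ S.functor a c)
      (F₂ := S.functor a b ⋙ postcomp (S.obj a) ((S.functor b c).obj g))
      (postcompComparison S.pseudofunctor a g).hom := by
  refine isMonoidal_of_map_comp_eq _ (F.mapFunctor (S.obj a) (S.obj c) ⋙ postcomp _ (S.app c))
    ((Functor.associator _ _ _).hom ≫ Functor.whiskerLeft (S.functor a b)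
      ((Functor.associator _ _ _).inv ≫
        Functor.whiskerRight
          (postcompComparison F.toPseudofunctor _ ((S.functor b c).obj g)).hom _ ≫
        (Functor.associator _ _ _).hom ≫
        Functor.whiskerLeft _ (postcompAssoc _ (F.map ((S.functor b c).obj g)) (S.app c)).hom ≫
        Functor.whiskerLeft _ (postcompMap _ (S.sq g).hom) ≫
        Functor.whiskerLeft _ (postcompAssoc _ _ _).inv ≫
        (Functor.associator _ _ _).inv) ≫
      (Functor.associator _ _ _).inv ≫
      Functor.whiskerRight (S.square a b).hom _ ≫ (middleAssoc _ _).hom) ?_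
    ((Functor.associator _ _ _).hom ≫ Functor.whiskerLeft (postcomp a g) (S.square a c).hom) ?_ ?_
  · refine isMonoidal_comp inferInstance (isMonoidal_comp (isMonoidal_whiskerLeft _ ?_) ?_)
    all_goals repeat' refine isMonoidal_comp ?_ ?_
    all_goals infer_instance
  · infer_instance
  · intro f
    have h := S.squareHom_fillerIso (S.sq (f ≫ g)) (compSquare _ (S.sq f) (S.sq g))
    rw [SquareHom, whiskerLeft_id, Category.comp_id] at h
    simp only [NatTrans.comp_app, Functor.whiskerLeft_app, Functor.associator_hom_app,
      Functor.associator_inv_app, Category.id_comp, Category.comp_id, Category.assoc]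
    exact h

/-- The SMC-functor inverse to `F`. -/
noncomputable def smcFunctor : SMCFunctor C B where
  toPseudofunctor := S.pseudofunctor
  braided c d := S.braided c d
  precomp_monoidal f c := S.precompComparison_monoidal f c
  postcomp_monoidal a _ _ g := S.postcompComparison_monoidal a g

/-- The monoidal transformation from the composite of the inverse with `F` to the identity. -/
noncomputable def smcCounit : SMCTrans (S.smcFunctor.comp F) (SMCFunctor.id C) where
  toStrongTrans := S.counit
  monoidal a b :=
    isMonoidal_of_app_eq
      (F := (S.functor a b ⋙ F.mapFunctor (S.obj a) (S.obj b)) ⋙ postcomp _ (S.app b))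
      (G := 𝟭 _ ⋙ precomp _ (S.app a))
      ((Functor.associator _ _ _).hom ≫ (S.square a b).hom ≫ (Functor.leftUnitor _).inv)
      inferInstance (fun f => by
        simp only [NatTrans.comp_app, Functor.associator_hom_app, Functor.leftUnitor_inv_app,
          Category.id_comp, Category.comp_id]
        rfl)

end SMCInverseData

namespace SMCFunctor

variable (F : SMCFunctor B C)

/-- The equivalence `g ↦ F g ≫ e_d` of hom-categories. -/
noncomputable def homEquivalence (hF : F.IsLocalEquivalence) (x : B) {y : B} {d : C}
    (e : F.obj y ≌ d) : (x ⟶ y) ≌ (F.obj x ⟶ d) :=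
  haveI := hF x y
  (F.mapFunctor x y).asEquivalence.trans (postcompEquivalence (F.obj x) e)

noncomputable instance (hF : F.IsLocalEquivalence) (x : B) {y : B} {d : C} (e : F.obj y ≌ d) :
    (F.homEquivalence hF x e).functor.Braided :=
  inferInstanceAs (F.mapFunctor x y ⋙ postcomp (F.obj x) e.hom).Braided

noncomputable instance (hF : F.IsLocalEquivalence) (x : B) {y : B} {d : C} (e : F.obj y ≌ d) :
    (F.homEquivalence hF x e).inverse.Braided :=
  braidedInverse _

instance (hF : F.IsLocalEquivalence) (x : B) {y : B} {d : C} (e : F.obj y ≌ d) :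
    NatTrans.IsMonoidal (F.homEquivalence hF x e).counit :=
  isMonoidal_counit _

/-- A choice of 0-cells `obj c` and equivalences `F (obj c) ≌ c` gives inverse data. -/
noncomputable def inverseData (hF : F.IsLocalEquivalence) (obj : C → B)
    (e : ∀ c, F.obj (obj c) ≌ c) : SMCInverseData F where
  obj := obj
  app c := (e c).hom
  -- The image `g` of `f` is determined by `F g ≫ (e d).hom ≅ (e c).hom ≫ f`; the counit of
  -- `homEquivalence` supplies this square.
  functor c d := precomp d (e c).hom ⋙ (F.homEquivalence hF (obj c) (e d)).inverse
  square c d := Functor.associator _ _ _ ≪≫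
    Functor.isoWhiskerLeft _ (F.homEquivalence hF (obj c) (e d)).counitIso ≪≫
    Functor.rightUnitor _
  full x d := (F.homEquivalence hF x (e d)).full_functor
  faithful x d := (F.homEquivalence hF x (e d)).faithful_functor
  braided c d := inferInstance
  square_monoidal c d := by
    change NatTrans.IsMonoidal (F₁ := (precomp d (e c).hom ⋙
        (F.homEquivalence hF (obj c) (e d)).inverse) ⋙ (F.homEquivalence hF (obj c) (e d)).functor)
      ((Functor.associator _ _ _).hom ≫
        Functor.whiskerLeft _ (F.homEquivalence hF (obj c) (e d)).counit ≫
        (Functor.rightUnitor _).hom)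
    infer_instance

end SMCFunctor

end InverseSMCFunctor

/-! ### Cancelling and lifting strong transformations -/

section StrongTrans

open Bicategory
open scoped Pseudofunctor.StrongTrans

variable {B : Type u₁} [Bicategory.{w₁, v₁} B] {C : Type u₂} [Bicategory.{w₂, v₂} C]
  {F G H : B ⥤ᵖ C}

/-- Replacing the components of a strong transformation by isomorphic ones. -/
def strongTransOfIso (η : F ⟶ G) (p : ∀ a, F.obj a ⟶ G.obj a) (u : ∀ a, η.app a ≅ p a) :
    Pseudofunctor.StrongTrans F G where
  app := p
  naturality {a b} f :=
    whiskerLeftIso (F.map f) (u b).symm ≪≫ η.naturality f ≪≫ whiskerRightIso (u a) (G.map f)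
  naturality_naturality {a b f g} θ := by
    have h := η.naturality_naturality θ
    simp only [Iso.trans_hom, whiskerLeftIso_hom, whiskerRightIso_hom, Iso.symm_hom,
      Category.assoc]
    rw [← whisker_exchange_assoc, reassoc_of% h, whisker_exchange]
  naturality_id a := by
    have h := η.naturality_id a
    simp only [Iso.trans_hom, whiskerLeftIso_hom, whiskerRightIso_hom, Iso.symm_hom,
      Category.assoc]
    rw [← whisker_exchange, reassoc_of% h, whisker_exchange_assoc]
    simp
  naturality_comp f g := by
    have h := η.naturality_comp f g
    simp only [Iso.trans_hom, whiskerLeftIso_hom, whiskerRightIso_hom, Iso.symm_hom,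
      Category.assoc]
    rw [← whisker_exchange, reassoc_of% h, whisker_exchange_assoc]
    simp

theorem whiskerLeft_injective {a b c : C} (p : a ⟶ b) [(precomp c p).Faithful] {q r : b ⟶ c}
    {α β : q ⟶ r} (h : p ◁ α = p ◁ β) : α = β :=
  (precomp c p).map_injective h

section Cancel

variable (η : F ⟶ G) (τ : F ⟶ H) (ι : ∀ a, G.obj a ⟶ H.obj a)
    (u : ∀ a, τ.app a ≅ η.app a ≫ ι a)

/-- The naturality isomorphism of `τ`, transported to the components `η ≫ ι`. -/
def transportedNaturality {a b : B} (f : a ⟶ b) :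
    F.map f ≫ η.app b ≫ ι b ≅ (η.app a ≫ ι a) ≫ H.map f :=
  (strongTransOfIso τ _ u).naturality f

/-- This and the next two results are the axioms of `strongTransOfIso` with the components `η.app a
≫ ι a` displayed for rewriting. -/
theorem transportedNaturality_naturality {a b : B} {f g : a ⟶ b} (θ : f ⟶ g) :
    F.map₂ θ ▷ (η.app b ≫ ι b) ≫ (transportedNaturality η τ ι u g).hom =
      (transportedNaturality η τ ι u f).hom ≫ (η.app a ≫ ι a) ◁ H.map₂ θ :=
  (strongTransOfIso τ _ u).naturality_naturality θ

theorem transportedNaturality_id (a : B) :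
    (transportedNaturality η τ ι u (𝟙 a)).hom ≫ (η.app a ≫ ι a) ◁ (H.mapId a).hom =
      (F.mapId a).hom ▷ (η.app a ≫ ι a) ≫ (λ_ (η.app a ≫ ι a)).hom ≫
        (ρ_ (η.app a ≫ ι a)).inv :=
  (strongTransOfIso τ _ u).naturality_id a

theorem transportedNaturality_comp {a b c : B} (f : a ⟶ b) (g : b ⟶ c) :
    (transportedNaturality η τ ι u (f ≫ g)).hom ≫ (η.app a ≫ ι a) ◁ (H.mapComp f g).hom =
      (F.mapComp f g).hom ▷ (η.app c ≫ ι c) ≫ (α_ _ _ _).hom ≫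
        F.map f ◁ (transportedNaturality η τ ι u g).hom ≫ (α_ _ _ _).inv ≫
          (transportedNaturality η τ ι u f).hom ▷ H.map g ≫ (α_ _ _ _).hom :=
  (strongTransOfIso τ _ u).naturality_comp f g

variable [∀ (a : B) (x : C), (precomp x (η.app a)).Full]
  [∀ (a : B) (x : C), (precomp x (η.app a)).Faithful]

/-- The naturality isomorphism of the transformation `ι` with `τ ≅ η ≫ ι`. -/
noncomputable def cancelNaturality {a b : B} (f : a ⟶ b) : G.map f ≫ ι b ≅ ι a ≫ H.map f :=
  (precomp _ (η.app a)).preimageIso ((α_ _ _ _).symm ≪≫ whiskerRightIso (η.naturality f).symm _ ≪≫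
    α_ _ _ _ ≪≫ transportedNaturality η τ ι u f ≪≫ α_ _ _ _)

theorem whiskerLeft_cancelNaturality {a b : B} (f : a ⟶ b) :
    η.app a ◁ (cancelNaturality η τ ι u f).hom =
    (α_ _ _ _).inv ≫ (η.naturality f).inv ▷ _ ≫
    (α_ _ _ _).hom ≫ (transportedNaturality η τ ι u f).hom ≫ (α_ _ _ _).hom :=
  (precomp _ (η.app a)).map_preimage _

theorem whiskerLeft_cancelNaturality_comp {a b : B} (f : a ⟶ b) :
    η.app a ◁ (cancelNaturality η τ ι u f).hom ≫ (α_ _ _ _).inv =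
    (α_ _ _ _).inv ≫ (η.naturality f).inv ▷ _ ≫
    (α_ _ _ _).hom ≫ (transportedNaturality η τ ι u f).hom := by
  simp [whiskerLeft_cancelNaturality]

/-- Substituted into the axioms for `τ`, this pasting formula leaves the axioms for `ι` whiskered by
`η`, once the invertible cells of `η` are cancelled. -/
theorem transportedNaturality_eq {a b : B} (f : a ⟶ b) :
    (transportedNaturality η τ ι u f).hom =
      (α_ _ _ _).inv ≫ (η.naturality f).hom ▷ _ ≫ (α_ _ _ _).hom ≫
        η.app a ◁ (cancelNaturality η τ ι u f).hom ≫ (α_ _ _ _).inv := by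
  rw [whiskerLeft_cancelNaturality]
  simp

/-- If `η` and `τ ≅ η ≫ ι` are strong transformations and precomposition with the components of `η`
is fully faithful, then `ι` is a strong transformation. -/
noncomputable def strongTransCancel :
    Pseudofunctor.StrongTrans G H where
  app := ι
  naturality f := cancelNaturality η τ ι u f
  naturality_naturality {a b f g} θ := whiskerLeft_injective (η.app a) (by
    have h := transportedNaturality_naturality η τ ι u θ
    have h' := congrArg (· ▷ ι b) (η.naturality_naturality θ)
    simp only [comp_whiskerRight, whisker_assoc] at h'
    simp [transportedNaturality_eq, reassoc_of% h'] at h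
    rw [cancel_epi] at h
    rw [← cancel_mono (α_ (η.app a) (ι a) (H.map g)).inv]
    simpa using h)
  naturality_id a := whiskerLeft_injective (η.app a) (by
    have h := transportedNaturality_id η τ ι u a
    simp [transportedNaturality_eq, η.naturality_id_hom] at h
    rw [cancel_epi] at h
    rw [← cancel_epi (η.app a ◁ (G.mapId a).inv ▷ ι a), ← cancel_epi (η.app a ◁ (λ_ (ι a)).inv),
      ← cancel_mono (α_ (η.app a) (ι a) (𝟙 (H.obj a))).inv]
    simpa using h)
  naturality_comp {a b c} f g := whiskerLeft_injective (η.app a) (by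
    have h := transportedNaturality_comp η τ ι u f g
    simp [transportedNaturality_eq, η.naturality_comp_hom] at h
    -- Interchange moves the cell of `η` at `f` before the cell of `ι` at `g`, so that all cells of
    -- `η` come first and cancel.
    rw [associator_inv_naturality_right_assoc, ← associator_inv_naturality_left_assoc,
      whisker_exchange_assoc] at h
    simp at h
    simp only [cancel_epi] at h
    rw [← cancel_epi (η.app a ◁ (G.mapComp f g).inv ▷ ι c), ← cancel_epi (α_ _ _ _).hom,
      ← cancel_epi ((α_ _ _ _).hom ▷ _), ← cancel_mono (α_ _ _ _).inv]
    simpa using h)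

/-- `τ` is isomorphic to the composite of `η` with the cancelled transformation. -/
noncomputable def strongTransCancelIso :
    η ≫ (show G ⟶ H from strongTransCancel η τ ι u) ≅ τ :=
  Pseudofunctor.StrongTrans.isoMk (fun a => (u a).symm) (fun {a b} f => by
    have h : F.map f ◁ (u b).inv ≫ (τ.naturality f).hom ≫ (u a).hom ▷ H.map f =
        ((η ≫ (show G ⟶ H from strongTransCancel η τ ι u)).naturality f).hom :=
      transportedNaturality_eq η τ ι u f
    have h' : F.map f ◁ (u b).inv ≫ (τ.naturality f).hom =
        (F.map f ◁ (u b).inv ≫ (τ.naturality f).hom ≫ (u a).hom ▷ H.map f) ≫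
          (u a).inv ▷ H.map f := by simp
    exact h'.trans (congrArg (· ≫ (u a).inv ▷ H.map f) h))

end Cancel

section Lift

variable {D : Type u₃} [Bicategory.{w₃, v₃} D] {P Q : D ⥤ᵖ B} (K : B ⥤ᵖ C)
  (σ : P.comp K ⟶ Q.comp K) (l : ∀ a, P.obj a ⟶ Q.obj a) (u : ∀ a, σ.app a ≅ K.map (l a))

/-- The naturality isomorphism of `σ`, transported to the components `K (l a)`. -/
def mappedNaturality {a b : D} (f : a ⟶ b) :
    K.map (P.map f) ≫ K.map (l b) ≅ K.map (l a) ≫ K.map (Q.map f) :=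
  (strongTransOfIso σ _ u).naturality f

theorem mappedNaturality_naturality {a b : D} {f g : a ⟶ b} (θ : f ⟶ g) :
    K.map₂ (P.map₂ θ) ▷ K.map (l b) ≫ (mappedNaturality K σ l u g).hom =
      (mappedNaturality K σ l u f).hom ≫ K.map (l a) ◁ K.map₂ (Q.map₂ θ) :=
  (strongTransOfIso σ _ u).naturality_naturality θ

theorem mappedNaturality_id (a : D) :
    (mappedNaturality K σ l u (𝟙 a)).hom ≫
        K.map (l a) ◁ (K.map₂ (Q.mapId a).hom ≫ (K.mapId _).hom) =
      (K.map₂ (P.mapId a).hom ≫ (K.mapId _).hom) ▷ K.map (l a) ≫ (λ_ _).hom ≫ (ρ_ _).inv :=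
  (strongTransOfIso σ _ u).naturality_id a

theorem mappedNaturality_comp {a b c : D} (f : a ⟶ b) (g : b ⟶ c) :
    (mappedNaturality K σ l u (f ≫ g)).hom ≫
        K.map (l a) ◁ (K.map₂ (Q.mapComp f g).hom ≫ (K.mapComp _ _).hom) =
      (K.map₂ (P.mapComp f g).hom ≫ (K.mapComp _ _).hom) ▷ K.map (l c) ≫ (α_ _ _ _).hom ≫
        K.map (P.map f) ◁ (mappedNaturality K σ l u g).hom ≫ (α_ _ _ _).inv ≫
          (mappedNaturality K σ l u f).hom ▷ K.map (Q.map g) ≫ (α_ _ _ _).hom :=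
  (strongTransOfIso σ _ u).naturality_comp f g

variable [∀ a b, (K.mapFunctor a b).Full] [∀ a b, (K.mapFunctor a b).Faithful]

/-- The naturality isomorphism of the lift of `σ` along `K`. -/
noncomputable def liftNaturality {a b : D} (f : a ⟶ b) : P.map f ≫ l b ≅ l a ≫ Q.map f :=
  (K.mapFunctor _ _).preimageIso (K.mapComp _ _ ≪≫ mappedNaturality K σ l u f ≪≫
    (K.mapComp _ _).symm)

@[simp]
theorem map₂_liftNaturality {a b : D} (f : a ⟶ b) :
    K.map₂ (liftNaturality K σ l u f).hom = (K.mapComp _ _).hom ≫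
      (mappedNaturality K σ l u f).hom ≫ (K.mapComp _ _).inv :=
  (K.mapFunctor _ _).map_preimage _

theorem map₂_liftNaturality_comp {a b : D} (f : a ⟶ b) :
    K.map₂ (liftNaturality K σ l u f).hom ≫ (K.mapComp _ _).hom =
      (K.mapComp _ _).hom ≫ (mappedNaturality K σ l u f).hom := by
  simp

/-- A strong transformation between composites with a locally fully faithful pseudofunctor `K`
whose components are in the image of `K` lifts along `K`. -/
noncomputable def strongTransLift : Pseudofunctor.StrongTrans P Q where
  app := l
  naturality f := liftNaturality K σ l u f
  naturality_naturality θ := (K.mapFunctor _ _).map_injective (by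
    have h := mappedNaturality_naturality K σ l u θ
    change K.map₂ _ = K.map₂ _
    simp [reassoc_of% h])
  naturality_id a := (K.mapFunctor _ _).map_injective (by
    have h := mappedNaturality_id K σ l u a
    change K.map₂ _ = K.map₂ _
    simp at h
    simp [K.mapComp_id_right_inv, reassoc_of% h])
  naturality_comp f g := (K.mapFunctor _ _).map_injective (by
    have h := mappedNaturality_comp K σ l u f g
    change K.map₂ _ = K.map₂ _
    simp at h
    -- Between the images of the two naturality cells, the compositors of `K` and the image of the
    -- associator collapse to an associator of `C`.
    have h' : K.map (P.map f) ◁ (K.mapComp (l _) (Q.map g)).inv ≫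
        (K.mapComp (P.map f) (l _ ≫ Q.map g)).inv ≫ K.map₂ (α_ (P.map f) (l _) (Q.map g)).inv ≫
          (K.mapComp (P.map f ≫ l _) (Q.map g)).hom ≫
            (K.mapComp (P.map f) (l _)).hom ▷ K.map (Q.map g) = (α_ _ _ _).inv := by
      rw [K.mapComp_assoc_right_inv_assoc, ← K.map₂_comp_assoc, Iso.hom_inv_id, K.map₂_id]
      simp
    simp [reassoc_of% h']
    rw [← reassoc_of% h]
    simp)

end Lift

end StrongTrans

/-! ### Monoidal transformations with invertible components -/

section SMCTransConstructions

open Bicategory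
open scoped Pseudofunctor.StrongTrans

variable {B : Type u₁} [Bicategory.{w₁, v₁} B] [SMCCategory B]
  {C : Type u₂} [Bicategory.{w₂, v₂} C] [SMCCategory C]

namespace SMCTrans

variable {F G H : SMCFunctor B C}

/-- Replacing the components of a monoidal transformation by isomorphic ones. -/
def ofIso (η : SMCTrans F G) (p : ∀ a, F.obj a ⟶ G.obj a)
    (u : ∀ a, η.toStrongTrans.app a ≅ p a) : SMCTrans F G where
  toStrongTrans := strongTransOfIso η.toStrongTrans p u
  monoidal a b :=
    isMonoidal_of_app_eq
      (F := F.mapFunctor a b ⋙ postcomp (F.obj a) (p b))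
      (G := G.mapFunctor a b ⋙ precomp (G.obj b) (p a))
      (Functor.whiskerLeft _ (postcompMap _ (u b).inv) ≫
        (transComparison η.toStrongTrans a b).hom ≫
        Functor.whiskerLeft _ (precompMap _ (u a).hom))
      inferInstance (fun _ => rfl)

variable (η : SMCTrans F G) (τ : SMCTrans F H) (ι : ∀ a, G.obj a ⟶ H.obj a)
    (u : ∀ a, τ.toStrongTrans.app a ≅ η.toStrongTrans.app a ≫ ι a)
    [∀ (a : B) (x : C), (precomp x (η.toStrongTrans.app a)).Full]
    [∀ (a : B) (x : C), (precomp x (η.toStrongTrans.app a)).Faithful]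

/-- If `η` and `τ ≅ η ≫ ι` are monoidal transformations and precomposition with the components of
`η` is fully faithful, then `ι` is a monoidal transformation. -/
noncomputable def cancel : SMCTrans G H where
  toStrongTrans := strongTransCancel η.toStrongTrans τ.toStrongTrans ι u
  monoidal a b := by
    -- The naturality of `T` is the transported naturality of `τ`, now known to be monoidal;
    -- whiskering `ι` by `η` expresses it through this and the inverse naturality of `η`.
    let T := τ.ofIso _ u
    refine isMonoidal_of_map_comp_eq (F := G.mapFunctor a b ⋙ postcomp (G.obj a) (ι b))
      (F' := H.mapFunctor a b ⋙ precomp (H.obj b) (ι a)) _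
      (precomp (H.obj b) (η.toStrongTrans.app a))
      ((Functor.associator _ _ _).hom ≫ Functor.whiskerLeft (H.mapFunctor a b)
        (precompAssoc (η.toStrongTrans.app a) (ι a) (H.obj b)).inv) ?_
      ((Functor.associator _ _ _).hom ≫ Functor.whiskerLeft _ (middleAssoc _ _).inv ≫
        (Functor.associator _ _ _).inv ≫
        Functor.whiskerRight (transComparison η.toStrongTrans a b).inv _ ≫
        (Functor.associator _ _ _).hom ≫
        Functor.whiskerLeft _ (postcompAssoc _ (η.toStrongTrans.app b) (ι b)).hom ≫
        (transComparison T.toStrongTrans a b).hom) ?_ ?_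
    · infer_instance
    · repeat' refine isMonoidal_comp ?_ ?_
      all_goals first | exact T.monoidal a b | infer_instance
    · intro f
      have h := whiskerLeft_cancelNaturality_comp η.toStrongTrans τ.toStrongTrans ι u f
      simp only [NatTrans.comp_app, Functor.whiskerLeft_app, Functor.associator_hom_app,
        Functor.associator_inv_app, Category.id_comp]
      exact h

/-- `τ` is isomorphic to the composite of `η` with the cancelled transformation. -/
noncomputable def cancelIso : η.comp (η.cancel τ ι u) ≅ τ :=
  SMCTrans.isoMk (strongTransCancelIso η.toStrongTrans τ.toStrongTrans ι u)

end SMCTrans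

section Lift

variable {D : Type u₃} [Bicategory.{w₃, v₃} D] [SMCCategory D] {P Q : SMCFunctor D B}
  (K : SMCFunctor B C) (σ : SMCTrans (P.comp K) (Q.comp K)) (l : ∀ a, P.obj a ⟶ Q.obj a)
  (u : ∀ a, σ.toStrongTrans.app a ≅ K.map (l a))
  [∀ a b, (K.mapFunctor a b).Full] [∀ a b, (K.mapFunctor a b).Faithful]

/-- A monoidal transformation between composites with a locally fully faithful SMC-functor `K`
whose components are in the image of `K` lifts along `K`. -/
noncomputable def SMCTrans.lift : SMCTrans P Q where
  toStrongTrans := strongTransLift K.toPseudofunctor σ.toStrongTrans l u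
  monoidal a b := by
    let T := σ.ofIso _ u
    refine isMonoidal_of_map_comp_eq (F := P.mapFunctor a b ⋙ postcomp (P.obj a) (l b))
      (F' := Q.mapFunctor a b ⋙ precomp (Q.obj b) (l a)) _
      (K.mapFunctor (P.obj a) (Q.obj b))
      ((Functor.associator _ _ _).hom ≫ Functor.whiskerLeft (Q.mapFunctor a b)
        (precompComparison K.toPseudofunctor (l a) (Q.obj b)).hom ≫
        (Functor.associator _ _ _).inv) ?_
      ((Functor.associator _ _ _).hom ≫ Functor.whiskerLeft (P.mapFunctor a b)
        (postcompComparison K.toPseudofunctor (P.obj a) (l b)).hom ≫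
        (Functor.associator _ _ _).inv ≫ (transComparison T.toStrongTrans a b).hom) ?_ ?_
    · infer_instance
    · repeat' refine isMonoidal_comp ?_ ?_
      all_goals first | exact T.monoidal a b | infer_instance
    · intro f
      have h := map₂_liftNaturality_comp K.toPseudofunctor σ.toStrongTrans l u f
      simp only [NatTrans.comp_app, Functor.whiskerLeft_app, Functor.associator_hom_app,
        Functor.associator_inv_app, Category.id_comp, Category.comp_id]
      exact h.trans (congrArg (_ ≫ ·) (Category.id_comp _).symm)

end Lift

section Equivalence

variable {F G : SMCFunctor B C}

/-- A monoidal transformation whose components are equivalences has a right inverse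
whose components are equivalences. -/
theorem SMCTrans.exists_rightInverse (η : F ⟶ G) (e : ∀ a, F.obj a ≌ G.obj a)
    (he : ∀ a, (e a).hom = η.toStrongTrans.app a) :
    ∃ ι : G ⟶ F, (∀ a, ι.toStrongTrans.app a = (e a).inv) ∧ Nonempty (η ≫ ι ≅ 𝟙 F) := by
  have h (a : B) (x : C) : (precomp x (η.toStrongTrans.app a)).IsEquivalence :=
    he a ▸ isEquivalence_precomp (e a) x
  -- The units factor the identity transformation of `F` through the components of `η`, so
  -- cancelling `η` from it makes the inverses a transformation.
  let u (a : B) : 𝟙 (F.obj a) ≅ η.toStrongTrans.app a ≫ (e a).inv :=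
    (e a).unit ≪≫ whiskerRightIso (eqToIso (he a)) _
  exact ⟨SMCTrans.cancel η (SMCTrans.id F) (fun a => (e a).inv) u, fun _ => rfl,
    ⟨SMCTrans.cancelIso η (SMCTrans.id F) (fun a => (e a).inv) u⟩⟩

/-- A monoidal transformation whose components are equivalences is an equivalence in the
bicategory of SMC-functors. -/
theorem SMCTrans.nonempty_equivalence (η : F ⟶ G) (e : ∀ a, F.obj a ≌ G.obj a)
    (he : ∀ a, (e a).hom = η.toStrongTrans.app a) : Nonempty (F ≌ G) := by
  obtain ⟨ι, hι, ⟨u⟩⟩ := SMCTrans.exists_rightInverse η e he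
  -- Cancellation yields only right inverses. The components of `ι` are again equivalences, so it
  -- applies a second time, and then `κ` is isomorphic to `η`.
  obtain ⟨κ, -, ⟨v⟩⟩ := SMCTrans.exists_rightInverse ι
    (fun a => equivalenceSymm (e a)) (fun a => (hι a).symm)
  exact ⟨equivalenceOfRightInverses η ι κ u v⟩

end Equivalence

end SMCTransConstructions

/-! ### The two implications -/

section Biequivalence

open Bicategory
open scoped Pseudofunctor.StrongTrans

variable {B : Type u₁} [Bicategory.{w₁, v₁} B] [SMCCategory B]
  {C : Type u₂} [Bicategory.{w₂, v₂} C] [SMCCategory C]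

/-- The components of an equivalence of SMC-functors are equivalences. -/
def SMCFunctor.componentEquivalence {F G : SMCFunctor B C} (e : F ≌ G) (a : B) :
    F.obj a ≌ G.obj a :=
  Equivalence.mkOfAdjointifyCounit (f := e.hom.toStrongTrans.app a)
    (g := e.inv.toStrongTrans.app a)
    { hom := e.unit.hom.as.app a
      inv := e.unit.inv.as.app a
      hom_inv_id := congrArg (fun Γ => Γ.as.app a) e.unit.hom_inv_id
      inv_hom_id := congrArg (fun Γ => Γ.as.app a) e.unit.inv_hom_id }
    { hom := e.counit.hom.as.app a
      inv := e.counit.inv.as.app a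
      hom_inv_id := congrArg (fun Γ => Γ.as.app a) e.counit.hom_inv_id
      inv_hom_id := congrArg (fun Γ => Γ.as.app a) e.counit.inv_hom_id }

/-- An SMC-functor equivalent to a local equivalence is a local equivalence. -/
theorem SMCFunctor.IsLocalEquivalence.of_equivalence {F G : SMCFunctor B C} (e : F ≌ G)
    (hG : G.IsLocalEquivalence) : F.IsLocalEquivalence := fun a b => by
  have := hG a b
  have : (precomp (G.obj b) (e.hom.toStrongTrans.app a)).IsEquivalence :=
    isEquivalence_precomp (componentEquivalence e a) (G.obj b)
  have := isEquivalence_postcomp (F.obj a) (componentEquivalence e b)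
  -- Naturality of `e.hom` identifies this functor with `G.mapFunctor a b` followed by a
  -- precomposition equivalence.
  have : (F.mapFunctor a b ⋙ postcomp (F.obj a) (componentEquivalence e b).hom).IsEquivalence :=
    Functor.isEquivalence_of_iso (transComparison e.hom.toStrongTrans a b).symm
  exact Functor.isEquivalence_of_comp_right _ (postcomp (F.obj a) (componentEquivalence e b).hom)

theorem SMCFunctor.isLocalEquivalence_id : (SMCFunctor.id C).IsLocalEquivalence := fun a b =>
  inferInstanceAs (𝟭 (a ⟶ b)).IsEquivalence

/-- The two-out-of-six property of equivalences of categories. -/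
theorem isEquivalence_of_comp_of_comp {X : Type*} [Category X] {Y : Type*} [Category Y]
    {Z : Type*} [Category Z] {W : Type*} [Category W] (F : X ⥤ Y) (G : Y ⥤ Z) (H : Z ⥤ W)
    (hFG : (F ⋙ G).IsEquivalence) (hGH : (G ⋙ H).IsEquivalence) : F.IsEquivalence := by
  have : G.EssSurj := ⟨fun z => ⟨F.obj ((F ⋙ G).objPreimage z),
    ⟨(F ⋙ G).objObjPreimageIso z⟩⟩⟩
  have : G.Faithful := Functor.Faithful.of_comp G H
  -- Fullness of `G` follows from that of `G ⋙ H` once `H` is faithful. For that, `F ⋙ G ⋙ H` is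
  -- faithful, and composing with the inverse of `F ⋙ G` recovers `H` up to isomorphism.
  have : G.Full := by
    have : F.Faithful := Functor.Faithful.of_comp F G
    have : ((F ⋙ G) ⋙ H).Faithful := inferInstanceAs (F ⋙ G ⋙ H).Faithful
    have : ((F ⋙ G).asEquivalence.inverse ⋙ (F ⋙ G).asEquivalence.functor ⋙ H).Faithful :=
      inferInstanceAs ((F ⋙ G).inv ⋙ (F ⋙ G) ⋙ H).Faithful
    have : H.Faithful := Functor.Faithful.of_iso ((F ⋙ G).asEquivalence.invFunIdAssoc H)
    exact Functor.Full.of_comp_faithful G H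
  have : G.IsEquivalence := {}
  exact Functor.isEquivalence_of_comp_right F G

/-- Two-out-of-six for the action on homs of `F`, `G`, `F` in succession: both consecutive
composites are equivalent to identities. -/
theorem SMCFunctor.IsBiequivalence.isLocalEquivalence {F : SMCFunctor B C}
    (hF : F.IsBiequivalence) : F.IsLocalEquivalence := by
  obtain ⟨G, ⟨e⟩, ⟨e'⟩⟩ := hF
  have h₁ := IsLocalEquivalence.of_equivalence e isLocalEquivalence_id
  have h₂ := IsLocalEquivalence.of_equivalence (equivalenceSymm e') isLocalEquivalence_id
  exact fun a b => isEquivalence_of_comp_of_comp (F.mapFunctor a b) (G.mapFunctor _ _)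
    (F.mapFunctor _ _) (h₂ a b) (h₁ (F.obj a) (F.obj b))

theorem SMCFunctor.IsBiequivalence.isEssSurjOnZeroCells {F : SMCFunctor B C}
    (hF : F.IsBiequivalence) : F.IsEssSurjOnZeroCells := by
  obtain ⟨G, ⟨e⟩, -⟩ := hF
  exact fun c => ⟨G.obj c, ⟨componentEquivalence e c⟩⟩

/-- Local equivalences reflect equivalences. -/
theorem SMCFunctor.IsLocalEquivalence.exists_equivalence {F : SMCFunctor B C}
    (hF : F.IsLocalEquivalence) {a b : B} (e : F.obj a ≌ F.obj b) :
    ∃ e' : a ≌ b, Nonempty (e.hom ≅ F.map e'.hom) := by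
  have (a b : B) : (F.mapFunctor a b).IsEquivalence := hF a b
  let f := (F.mapFunctor a b).objPreimage e.hom
  let g := (F.mapFunctor b a).objPreimage e.inv
  let i : F.map f ≅ e.hom := (F.mapFunctor a b).objObjPreimageIso e.hom
  let j : F.map g ≅ e.inv := (F.mapFunctor b a).objObjPreimageIso e.inv
  let u : 𝟙 a ≅ f ≫ g := (F.mapFunctor a a).preimageIso
    (F.mapId a ≪≫ e.unit ≪≫ whiskerRightIso i.symm _ ≪≫ whiskerLeftIso _ j.symm ≪≫
      (F.mapComp f g).symm)
  let v : g ≫ f ≅ 𝟙 b := (F.mapFunctor b b).preimageIso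
    (F.mapComp g f ≪≫ whiskerLeftIso _ i ≪≫ whiskerRightIso j _ ≪≫ e.counit ≪≫ (F.mapId b).symm)
  exact ⟨Equivalence.mkOfAdjointifyCounit u v, ⟨i.symm⟩⟩

section CounitPrecomp

variable {B : Type u₁} [Bicategory.{w₁, v₁} B] {C : Type u₂} [Bicategory.{w₂, v₂} C]
  {F : B ⥤ᵖ C} {G : C ⥤ᵖ B} (η : G.comp F ⟶ Pseudofunctor.id C)

/-- The components of a strong transformation to the identity. -/
def counitApp (c : C) : F.obj (G.obj c) ⟶ c :=
  η.app c

/-- The naturality isomorphisms of a strong transformation to the identity. -/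
def counitNaturality {c d : C} (f : c ⟶ d) :
    F.map (G.map f) ≫ counitApp η d ≅ counitApp η c ≫ f :=
  η.naturality f

theorem counitNaturality_naturality {c d : C} {f g : c ⟶ d} (θ : f ⟶ g) :
    F.map₂ (G.map₂ θ) ▷ counitApp η d ≫ (counitNaturality η g).hom =
      (counitNaturality η f).hom ≫ counitApp η c ◁ θ :=
  η.naturality_naturality θ

theorem counitNaturality_id (c : C) :
    (counitNaturality η (𝟙 c)).hom =
      (F.map₂ (G.mapId c).hom ≫ (F.mapId _).hom) ▷ counitApp η c ≫ (λ_ _).hom ≫ (ρ_ _).inv := by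
  have h : (counitNaturality η (𝟙 c)).hom ≫ counitApp η c ◁ 𝟙 _ = _ := η.naturality_id c
  rw [whiskerLeft_id, Category.comp_id] at h
  exact h

theorem counitNaturality_comp {c d e : C} (f : c ⟶ d) (g : d ⟶ e) :
    (counitNaturality η (f ≫ g)).hom =
      (F.map₂ (G.mapComp f g).hom ≫ (F.mapComp _ _).hom) ▷ counitApp η e ≫ (α_ _ _ _).hom ≫
        F.map (G.map f) ◁ (counitNaturality η g).hom ≫ (α_ _ _ _).inv ≫
          (counitNaturality η f).hom ▷ g ≫ (α_ _ _ _).hom := by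
  have h : (counitNaturality η (f ≫ g)).hom ≫ counitApp η c ◁ 𝟙 _ = _ := η.naturality_comp f g
  rw [whiskerLeft_id, Category.comp_id] at h
  exact h

/-- Precomposing a strong transformation to the identity with a pseudofunctor. -/
def counitPrecomp : Pseudofunctor.StrongTrans ((F.comp G).comp F) ((Pseudofunctor.id B).comp F) where
  app a := counitApp η (F.obj a)
  naturality f := counitNaturality η (F.map f)
  naturality_naturality θ := counitNaturality_naturality η (F.map₂ θ)
  naturality_id a := by
    -- Naturality in the 2-cell `F.mapId a` replaces the cell of `η` at `F.map (𝟙 a)` by that at an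
    -- identity; `F.mapComp` plays the same role for composites.
    have h := counitNaturality_naturality η (F.mapId a).hom
    rw [counitNaturality_id] at h
    have h' : (counitNaturality η (F.map (𝟙 a))).hom ≫
        counitApp η (F.obj a) ◁ (F.map₂ (𝟙 (𝟙 a)) ≫ (F.mapId a).hom) =
        (F.map₂ (G.map₂ (F.mapId a).hom ≫ (G.mapId _).hom) ≫ (F.mapId _).hom) ▷ _ ≫
          (λ_ _).hom ≫ (ρ_ _).inv := by
      rw [F.map₂_id, Category.id_comp, ← h]
      simp
    exact h'
  naturality_comp {a b c} f g := by
    have h := counitNaturality_naturality η (F.mapComp f g).hom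
    rw [counitNaturality_comp] at h
    have h' : (counitNaturality η (F.map (f ≫ g))).hom ≫
        counitApp η (F.obj a) ◁ (F.map₂ (𝟙 (f ≫ g)) ≫ (F.mapComp f g).hom) =
        (F.map₂ (G.map₂ (F.mapComp f g).hom ≫ (G.mapComp _ _).hom) ≫ (F.mapComp _ _).hom) ▷ _ ≫
          (α_ _ _ _).hom ≫ F.map (G.map (F.map f)) ◁ (counitNaturality η (F.map g)).hom ≫
            (α_ _ _ _).inv ≫ (counitNaturality η (F.map f)).hom ▷ F.map g ≫ (α_ _ _ _).hom := by
      rw [F.map₂_id, Category.id_comp, ← h]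
      simp
    exact h'

end CounitPrecomp

/-- Whiskering a monoidal transformation with a monoidal functor, up to reassociation. -/
theorem isMonoidal_of_app_eq_app_obj {X : Type*} [Category* X] [MonoidalCategory X]
    {Y : Type*} [Category* Y] [MonoidalCategory Y] {Z : Type*} [Category* Z] [MonoidalCategory Z]
    {W : Type*} [Category* W] [MonoidalCategory W] {V : Type*} [Category* V] [MonoidalCategory V]
    (P : X ⥤ Y) (Q : Y ⥤ Z) (R : Z ⥤ W) (K : W ⥤ V) (L : Y ⥤ V) [P.LaxMonoidal] [Q.LaxMonoidal]
    [R.LaxMonoidal] [K.LaxMonoidal] [L.LaxMonoidal] {σ : (Q ⋙ R) ⋙ K ⟶ 𝟭 Y ⋙ L}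
    (hσ : NatTrans.IsMonoidal σ) {τ : ((P ⋙ Q) ⋙ R) ⋙ K ⟶ (𝟭 X ⋙ P) ⋙ L}
    (h : ∀ x, τ.app x = σ.app (P.obj x)) : NatTrans.IsMonoidal τ :=
  isMonoidal_of_app_eq
    (Functor.whiskerRight (Functor.associator P Q R).hom K ≫
      (Functor.associator P (Q ⋙ R) K).hom ≫ Functor.whiskerLeft P (σ ≫ L.leftUnitor.hom) ≫
      Functor.whiskerRight P.leftUnitor.inv L) inferInstance (by simp [h])

/-- The natural isomorphism `F G f ≫ η_d ≅ η_c ≫ f` of functors of `f : c ⟶ d`. -/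
def counitComparison {F : SMCFunctor B C} {G : SMCFunctor C B}
    (η : SMCTrans (G.comp F) (SMCFunctor.id C)) (c d : C) :
    (G.mapFunctor c d ⋙ F.mapFunctor (G.obj c) (G.obj d)) ⋙
        postcomp (F.obj (G.obj c)) (counitApp η.toStrongTrans d) ≅
      𝟭 (c ⟶ d) ⋙ precomp d (counitApp η.toStrongTrans c) :=
  NatIso.ofComponents (fun f => counitNaturality η.toStrongTrans f)
    (fun θ => counitNaturality_naturality η.toStrongTrans θ)

theorem isMonoidal_counitComparison {F : SMCFunctor B C} {G : SMCFunctor C B}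
    (η : SMCTrans (G.comp F) (SMCFunctor.id C)) (c d : C) :
    NatTrans.IsMonoidal (counitComparison η c d).hom :=
  η.monoidal c d

/-- Precomposing a monoidal transformation to the identity with an SMC-functor. -/
def SMCTrans.counitPrecomp (F : SMCFunctor B C) (G : SMCFunctor C B)
    (η : SMCTrans (G.comp F) (SMCFunctor.id C)) :
    SMCTrans ((F.comp G).comp F) ((SMCFunctor.id B).comp F) where
  toStrongTrans := _root_.counitPrecomp η.toStrongTrans
  monoidal a b :=
    isMonoidal_of_app_eq_app_obj (F.mapFunctor a b) (G.mapFunctor (F.obj a) (F.obj b))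
      (F.mapFunctor (G.obj (F.obj a)) (G.obj (F.obj b)))
      (postcomp (F.obj (G.obj (F.obj a))) (counitApp η.toStrongTrans (F.obj b)))
      (precomp (F.obj b) (counitApp η.toStrongTrans (F.obj a)))
      (isMonoidal_counitComparison η (F.obj a) (F.obj b)) (fun _ => rfl)

theorem SMCFunctor.isBiequivalence_of {F : SMCFunctor B C} (hF : F.IsLocalEquivalence)
    (hF' : F.IsEssSurjOnZeroCells) : F.IsBiequivalence := by
  choose obj e using hF'
  replace e (c : C) := (e c).some
  let S := F.inverseData hF obj e
  obtain ⟨k⟩ := SMCTrans.nonempty_equivalence (F := S.smcFunctor.comp F) (G := SMCFunctor.id C)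
    S.smcCounit e (fun _ => rfl)
  -- The components of the counit at `F a` are equivalences between objects in the image of `F`,
  -- hence come from equivalences in `B`.
  choose l i using fun a => hF.exists_equivalence (a := obj (F.obj a)) (b := a) (e (F.obj a))
  have := fun a b => (hF a b).full
  have := fun a b => (hF a b).faithful
  -- The counit restricted along `F` has components isomorphic to the images of the `l a`, so it
  -- lifts through `F`.
  let ζ : SMCTrans (F.comp S.smcFunctor) (SMCFunctor.id B) :=
    SMCTrans.lift F (SMCTrans.counitPrecomp F S.smcFunctor S.smcCounit) (fun a => (l a).hom)
      (fun a => (i a).some)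
  obtain ⟨k'⟩ := SMCTrans.nonempty_equivalence (F := F.comp S.smcFunctor) (G := SMCFunctor.id B)
    ζ l (fun _ => rfl)
  exact ⟨S.smcFunctor, ⟨k⟩, ⟨equivalenceSymm k'⟩⟩

end Biequivalence

theorem proposition4p7 {B : Type u₁} [Bicategory.{w₁, v₁} B] [SMCCategory B]
    {C : Type u₂} [Bicategory.{w₂, v₂} C] [SMCCategory C] (F : SMCFunctor B C) :
    F.IsBiequivalence ↔ F.IsLocalEquivalence ∧ F.IsEssSurjOnZeroCells :=
  ⟨fun h => ⟨h.isLocalEquivalence, h.isEssSurjOnZeroCells⟩,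
    fun h => SMCFunctor.isBiequivalence_of h.1 h.2⟩
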